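/- Let $n\ge 3$, $V,\Lambda>0$, $\alpha\in(0,1)$, let $(\mathbb S^n,g_{\mathbb S^n})$ be the round unit sphere, and let $f_j:\mathbb S^n\to\mathbb R$, $j\in\mathbb N$, be smooth functions defining the conformal metrics $g_j=e^{2f_j}g_{\mathbb S^n}$. Suppose that for all $j$ the scalar curvature satisfies $\mathrm{Sc}_{g_j}\ge 0$, that $V^{-1}\le \mathrm{Vol}_{g_j}(\mathbb S^n)\le V$, and that $$\mathrm{Vol}_{g_j}(U)\le \Lambda\,\mathrm{Vol}_{g_{\mathbb S^n}}(U)^{\alpha}\qquad\text{for all measurable } U\subset\mathbb S^n .$$ Put $u_j=e^{\frac{(n-2)f_j}{2}}$. Then: (i) There are a subsequence $(u_{j_k})$ and a function $u_\infty$ on $\mathbb S^n$ such that $u_{j_k}\to u_\infty$ in $L^p(\mathbb S^n)$ for every $1\le p<\frac{2n}{n-2}$. (ii) Every $u_\infty\in L^1(\mathbb S^n)$ that is the $L^1$-limit of a subsequence of $(u_j)$ (in particular every limit as in (i)) is well defined everywhere, positive and lower semicontinuous, in the following sense. Let $\beta=1$ if $n\in\{3,4\}$ and $\beta=\frac{2}{n-2}$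 if $n\ge 5$, and let $B_s(x)$ denote the geodesic ball of radius $s$ about $x$ in $(\mathbb S^n,g_{\mathbb S^n})$. For every $x\in\mathbb S^n$ the limit $$\hat u_\infty(x):=\Big(\lim_{s\to 0^+}\frac{1}{\mathrm{Vol}_{g_{\mathbb S^n}}(B_s(x))}\int_{B_s(x)}u_\infty^{\beta}\,dV_{g_{\mathbb S^n}}\Big)^{1/\beta}$$ exists in $(0,\infty]$; one has $\hat u_\infty=u_\infty$ almost everywhere; and the function $\hat u_\infty:\mathbb S^n\to(0,\infty]$ is lower semicontinuous. Equivalently, $\hat u_\infty=e^{\frac{(n-2)f_\infty}{2}}$ with $f_\infty:\mathbb S^n\to(-\infty,\infty]$. -/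

import Mathlib

open MeasureTheory Filter Topology
open scoped ENNReal Manifold ContDiff

noncomputable section

/-- The unit sphere of dimension `n`, with Mathlib's topology and smooth structure
(stereographic charts). -/
abbrev Sph (n : ℕ) : Type := Metric.sphere (0 : EuclideanSpace ℝ (Fin (n + 1))) 1

/-- The volume measure of the round metric: the usual surface measure of the unit sphere. -/
def roundVol (n : ℕ) : Measure (Sph n) :=
  (volume : Measure (EuclideanSpace ℝ (Fin (n + 1)))).toSphere

/-- The open geodesic ball of radius `s` of the round sphere. The geodesic distance of two points
is the angle between them. -/
def geodBall {n : ℕ} (x : Sph n) (s : ℝ) : Set (Sph n) :=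
  {y | InnerProductGeometry.angle (x : EuclideanSpace ℝ (Fin (n + 1)))
    (y : EuclideanSpace ℝ (Fin (n + 1))) < s}

/-! Scalar curvature in coordinates. A Riemannian metric on an open set of `ℝⁿ` is given by its
matrix of coefficients `g y i j`. -/

/-- The partial derivative `∂ᵢ F` at `y`. -/
def pd {n : ℕ} (i : Fin n) (F : EuclideanSpace ℝ (Fin n) → ℝ) (y : EuclideanSpace ℝ (Fin n)) : ℝ :=
  fderiv ℝ F y (EuclideanSpace.single i 1)

/-- Christoffel symbols `Γᵏᵢⱼ = ½ ∑ₗ gᵏˡ (∂ᵢ gⱼₗ + ∂ⱼ gᵢₗ - ∂ₗ gᵢⱼ)`. -/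
def christoffel {n : ℕ} (g : EuclideanSpace ℝ (Fin n) → Matrix (Fin n) (Fin n) ℝ)
    (k i j : Fin n) (y : EuclideanSpace ℝ (Fin n)) : ℝ :=
  (1 / 2 : ℝ) * ∑ l, (g y)⁻¹ k l *
    (pd i (fun z => g z j l) y + pd j (fun z => g z i l) y - pd l (fun z => g z i j) y)

/-- Ricci curvature
`Ricᵢⱼ = ∑ₗ (∂ₗ Γˡᵢⱼ - ∂ⱼ Γˡᵢₗ) + ∑ₗₘ (Γˡₗₘ Γᵐᵢⱼ - Γˡⱼₘ Γᵐᵢₗ)`. -/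
def ricci {n : ℕ} (g : EuclideanSpace ℝ (Fin n) → Matrix (Fin n) (Fin n) ℝ)
    (i j : Fin n) (y : EuclideanSpace ℝ (Fin n)) : ℝ :=
  (∑ l, (pd l (christoffel g l i j) y - pd j (christoffel g l i l) y)) +
    ∑ l, ∑ m, (christoffel g l l m y * christoffel g m i j y -
      christoffel g l j m y * christoffel g m i l y)

/-- Scalar curvature `∑ᵢⱼ gⁱʲ Ricᵢⱼ`. -/
def coordScalarCurvature {n : ℕ} (g : EuclideanSpace ℝ (Fin n) → Matrix (Fin n) (Fin n) ℝ)
    (y : EuclideanSpace ℝ (Fin n)) : ℝ :=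
  ∑ i, ∑ j, (g y)⁻¹ i j * ricci g i j y

/-- The inverse of the chart of the sphere at `p`, as a map from `ℝⁿ` into `ℝⁿ⁺¹`. -/
def chartParam {n : ℕ} (p : Sph n) (y : EuclideanSpace ℝ (Fin n)) :
    EuclideanSpace ℝ (Fin (n + 1)) :=
  ((chartAt (EuclideanSpace ℝ (Fin n)) p).symm y : Sph n)

/-- The coefficients, in the chart of the sphere at `p`, of the conformal metric `e^{2f} g₀`, where
`g₀` is the round metric, that is, the metric induced by the inner product of `ℝⁿ⁺¹`. -/
def conformalMetric {n : ℕ} (f : Sph n → ℝ) (p : Sph n) (y : EuclideanSpace ℝ (Fin n)) :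
    Matrix (Fin n) (Fin n) ℝ :=
  Matrix.of fun i j =>
    Real.exp (2 * f ((chartAt (EuclideanSpace ℝ (Fin n)) p).symm y)) *
      inner ℝ (fderiv ℝ (chartParam p) y (EuclideanSpace.single i 1))
        (fderiv ℝ (chartParam p) y (EuclideanSpace.single j 1))

/-- The scalar curvature of the conformal metric `e^{2f} g₀` at the point `p`. -/
def scalarCurvature {n : ℕ} (f : Sph n → ℝ) (p : Sph n) : ℝ :=
  coordScalarCurvature (conformalMetric f p) (chartAt (EuclideanSpace ℝ (Fin n)) p p)

/-- The volume measure of the conformal metric `e^{2f} g₀`, with density `e^{nf}` with respect to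
the round volume. -/
def conformalVol {n : ℕ} (f : Sph n → ℝ) : Measure (Sph n) :=
  (roundVol n).withDensity fun x => ENNReal.ofReal (Real.exp (n * f x))

/-- The function `u = e^{(n-2)f/2}`. -/
def conformalFactor {n : ℕ} (f : Sph n → ℝ) (x : Sph n) : ℝ :=
  Real.exp (((n : ℝ) - 2) / 2 * f x)

/-- The function `u = e^{(n-2)f/2}` for `f` with values in `[-∞, ∞]`. -/
def extConformalFactor {n : ℕ} (f : Sph n → EReal) (x : Sph n) : ℝ≥0∞ :=
  EReal.exp ((((n : ℝ) - 2) / 2 : ℝ) * f x)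

/-- The power of the conformal factor whose ball averages define the limit pointwise:
`u` itself for `n ≤ 4` and `u^{2/(n-2)}` for `n ≥ 5`. -/
def meanExponent (n : ℕ) : ℝ := if n ≤ 4 then 1 else 2 / ((n : ℝ) - 2)

end

/-!
Let `g = e^{2f} g₀` be conformal to the round metric and `u = e^{(n-2)f/2}`. Instead of working
with the conformal Laplacian of the sphere, the proof extends `u` to the ambient space `ℝⁿ⁺¹` as a
function `homExt u` which is homogeneous of degree `(2 - n) / 2`. In this degree the scalar
curvature of `g` is nonnegative only if `homExt u` is superharmonic away from the origin
(`laplacian_homExt_nonpos`): in the stereographic chart about a point `p` the metric `g` is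
conformally flat, the scaled chart `y ↦ p + L y - (|y|² / 4) p` carries `homExt u` to the
corresponding flat conformal factor, and by Euler's identities the Laplacians agree at `p`.

A positive superharmonic function has decreasing means over concentric balls. This property,
`IsSuperMean`, involves only integrals, so it passes to the homogeneous extension of every `L¹`
limit of the conformal factors (`isSuperMean_of_tendsto`). The supremum of the ball means at a point
is then a lower semicontinuous representative of the limit (`lscReg`, `sphReg`), and the minimum
principle makes it positive everywhere unless the limit vanishes almost everywhere. Means over
geodesic balls are compared with ball means in the ambient space through the part of a thin shell
that lies over the geodesic ball (`eventually_laverage_geodBall_le`). Where the representative is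
finite this bounds the spherical means from above; the powers `β ≤ 1` follow by Jensen's inequality,
and the lower bound is semicontinuity (`tendsto_laverage_geodBall`).

For compactness, the volume bound controls the conformal factors in `L²`, so a subsequence
converges weakly and its ball means of any fixed radius converge pointwise. Since a superharmonic
function dominates its ball means, the `L¹` norm of the difference is an integral without absolute
value, and testing with a Lipschitz cutoff function bounds it by a multiple of the radius
(`setLIntegral_sub_ballMean_le`). Hence the subsequence is Cauchy in `L¹`
(`exists_subseq_tendsto_eLpNorm_one`).

The volume of `g` is the integral of `u` to the critical power `2n / (n - 2)`, so the bound of the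
conformal volume by a power of the round volume is uniform integrability of this power. Vitali's
theorem improves `L¹` convergence to convergence in the critical Lebesgue space
(`tendsto_conformalFactor_critical`). This gives all the exponents of the statement, and together
with the lower volume bound it keeps the limit from vanishing.
-/

/-! ### Mean values of superharmonic functions -/

section MeanValue

open Metric Laplacian InnerProductSpace

variable {E : Type*} [NormedAddCommGroup E]

/-- The function `(1 - |y|²) / 2`, cut off at the unit sphere. Its gradient is `-y` in the unit
ball and `0` outside. -/
noncomputable def ballPotential (y : E) : ℝ := (1 - (min ‖y‖ 1) ^ 2) / 2

theorem ballPotential_nonneg (y : E) : 0 ≤ ballPotential y := by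
  have h0 : 0 ≤ min ‖y‖ 1 := le_min (norm_nonneg _) zero_le_one
  have h1 : min ‖y‖ 1 ≤ 1 := min_le_right _ _
  unfold ballPotential
  nlinarith

theorem ballPotential_of_norm_ge {y : E} (hy : 1 ≤ ‖y‖) : ballPotential y = 0 := by
  simp [ballPotential, min_eq_right hy]

theorem lipschitzWith_ballPotential : LipschitzWith 1 (ballPotential : E → ℝ) := by
  refine LipschitzWith.of_dist_le_mul fun y z => ?_
  have ha0 : 0 ≤ min ‖y‖ 1 := le_min (norm_nonneg _) zero_le_one
  have ha1 : min ‖y‖ 1 ≤ 1 := min_le_right _ _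
  have hb0 : 0 ≤ min ‖z‖ 1 := le_min (norm_nonneg _) zero_le_one
  have hb1 : min ‖z‖ 1 ≤ 1 := min_le_right _ _
  have hab : |min ‖y‖ 1 - min ‖z‖ 1| ≤ dist y z := by
    refine (abs_min_sub_min_le_max _ _ _ _).trans (max_le ?_ (by simp))
    rw [dist_eq_norm]
    exact abs_norm_sub_norm_le y z
  rw [NNReal.coe_one, one_mul, Real.dist_eq]
  unfold ballPotential
  refine le_trans ?_ hab
  rw [show (1 - (min ‖y‖ 1) ^ 2) / 2 - (1 - (min ‖z‖ 1) ^ 2) / 2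
    = -((min ‖y‖ 1 - min ‖z‖ 1) * ((min ‖y‖ 1 + min ‖z‖ 1) / 2)) by ring, abs_neg, abs_mul]
  refine mul_le_of_le_one_right (abs_nonneg _) ?_
  rw [abs_of_nonneg (by positivity)]
  linarith

theorem hasCompactSupport_ballPotential [ProperSpace E] :
    HasCompactSupport (ballPotential : E → ℝ) :=
  HasCompactSupport.intro (isCompact_closedBall (0 : E) 1) fun y hy =>
    ballPotential_of_norm_ge (by simpa using (not_le.1 fun h => hy (by simpa using h)).le)

variable [InnerProductSpace ℝ E]

theorem laplacian_eq_sum_fderiv {ι : Type*} [Fintype ι] [FiniteDimensional ℝ E]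
    (b : OrthonormalBasis ι ℝ E) (w : E → ℝ) (x : E) :
    Δ w x = ∑ i, fderiv ℝ (fderiv ℝ w) x (b i) (b i) := by
  rw [laplacian_eq_iteratedFDeriv_orthonormalBasis w b]
  simp [iteratedFDeriv_two_apply]

theorem lineDeriv_ballPotential {y : E} (hy : ‖y‖ ≠ 1) (v : E) :
    lineDeriv ℝ ballPotential y (-v) = (ball (0 : E) 1).indicator (fun y => inner ℝ y v) y := by
  rcases lt_or_gt_of_ne hy with h | h
  · have hev : (ballPotential : E → ℝ) =ᶠ[𝓝 y] fun z => 2⁻¹ * (1 - ‖z‖ ^ 2) := by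
      filter_upwards [isOpen_ball.mem_nhds (show y ∈ ball (0 : E) 1 by simpa using h)] with z hz
      have : ‖z‖ < 1 := by simpa using hz
      simp [ballPotential, min_eq_left this.le, div_eq_inv_mul]
    have hd : HasFDerivAt (fun z : E => 2⁻¹ * (1 - ‖z‖ ^ 2))
        ((2⁻¹ : ℝ) • -((2 : ℝ) • innerSL ℝ y)) y := by
      have h1 := ((hasStrictFDerivAt_norm_sq (F := E) y).hasFDerivAt.const_sub 1).const_mul
        (2⁻¹ : ℝ)
      simpa [two_smul] using h1
    rw [(hd.congr_of_eventuallyEq hev).hasLineDerivAt (-v) |>.lineDeriv]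
    have : y ∈ ball (0 : E) 1 := by simpa using h
    simp [this]
  · have hev : (ballPotential : E → ℝ) =ᶠ[𝓝 y] fun _ => 0 := by
      filter_upwards [(isOpen_lt continuous_const continuous_norm).mem_nhds h] with z hz
      exact ballPotential_of_norm_ge (le_of_lt hz)
    rw [(((hasFDerivAt_const (0 : ℝ) y).congr_of_eventuallyEq hev).hasLineDerivAt (-v)).lineDeriv]
    have : y ∉ ball (0 : E) 1 := by simpa using h.le
    simp [this]

variable [FiniteDimensional ℝ E] [MeasurableSpace E] [BorelSpace E]

/-- Green's formula on the unit ball, for the pair of `ballPotential` and a compactly supported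
function composed with a dilation. -/
theorem setIntegral_fderiv_apply_self {W : E → ℝ} (hW : ContDiff ℝ 2 W) (hc : HasCompactSupport W)
    (x : E) (r : ℝ) :
    ∫ y in ball (0 : E) 1, fderiv ℝ W (x + r • y) y =
      r * ∫ y, Δ W (x + r • y) * ballPotential y := by
  have hD : ContDiff ℝ 1 (fderiv ℝ W) := hW.fderiv_right le_rfl
  have hDc : HasCompactSupport (fderiv ℝ W) := hc.fderiv ℝ
  have hDD : Continuous (fderiv ℝ (fderiv ℝ W)) := hD.continuous_fderiv one_ne_zero
  obtain ⟨C, hC⟩ := hD.lipschitzWith_of_hasCompactSupport hDc one_ne_zero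
  have hsph : ∀ᵐ y : E ∂volume, ‖y‖ ≠ 1 := by
    have : volume (sphere (0 : E) 1) = 0 := Measure.addHaar_sphere_of_ne_zero _ _ one_ne_zero
    rw [ae_iff]
    refine measure_mono_null (fun y hy => ?_) this
    simpa using hy
  have haff : LipschitzWith (Real.nnabs r) fun y : E => x + r • y :=
    LipschitzWith.of_dist_le_mul fun y z => by
      simp [dist_eq_norm, ← smul_sub, norm_smul]
  set b := stdOrthonormalBasis ℝ E
  have key : ∀ i, ∫ y, (r * fderiv ℝ (fderiv ℝ W) (x + r • y) (b i) (b i)) * ballPotential y =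
      ∫ y in ball (0 : E) 1, inner ℝ y (b i) * fderiv ℝ W (x + r • y) (b i) := by
    intro i
    have hev : LipschitzWith 1 fun L : E →L[ℝ] ℝ => L (b i) :=
      LipschitzWith.of_dist_le_mul fun L M => by
        rw [dist_eq_norm, dist_eq_norm, ← sub_apply]
        simpa using (L - M).le_opNorm (b i)
    have hlip := (hev.comp hC).comp haff
    have := LipschitzWith.integral_lineDeriv_mul_eq (μ := volume) hlip lipschitzWith_ballPotential
      hasCompactSupport_ballPotential (b i)
    rw [← integral_indicator measurableSet_ball]
    convert this using 1
    · refine integral_congr_ae (ae_of_all _ fun y => ?_)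
      dsimp only
      congr 1
      have h1 : HasFDerivAt (fun y => fderiv ℝ W (x + r • y))
          ((fderiv ℝ (fderiv ℝ W) (x + r • y)).comp (r • ContinuousLinearMap.id ℝ E)) y := by
        refine HasFDerivAt.comp y ((hD.differentiable one_ne_zero) _).hasFDerivAt ?_
        exact ((hasFDerivAt_id y).const_smul r).const_add x
      have h2 := ((ContinuousLinearMap.apply ℝ ℝ (b i)).hasFDerivAt.comp y h1).hasLineDerivAt (b i)
      refine Eq.trans ?_ h2.lineDeriv.symm
      simp
    · refine integral_congr_ae ?_
      filter_upwards [hsph] with y hy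
      rw [lineDeriv_ballPotential hy]
      by_cases h : y ∈ ball (0 : E) 1 <;> simp [h]
  have hint : ∀ i, Integrable (fun y : E => inner ℝ y (b i) * fderiv ℝ W (x + r • y) (b i))
      (volume.restrict (ball 0 1)) := fun i => by
    refine IntegrableOn.mono_set (t := closedBall 0 1) ?_ ball_subset_closedBall
    refine ContinuousOn.integrableOn_compact (isCompact_closedBall _ _) ?_
    have := hD.continuous
    fun_prop
  have hint2 : ∀ i, Integrable (fun y : E => (r * fderiv ℝ (fderiv ℝ W) (x + r • y) (b i) (b i)) *
      ballPotential y) := fun i => by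
    refine Continuous.integrable_of_hasCompactSupport ?_
      (hasCompactSupport_ballPotential.mul_left)
    have := (lipschitzWith_ballPotential (E := E)).continuous
    fun_prop
  calc ∫ y in ball (0 : E) 1, fderiv ℝ W (x + r • y) y
      = ∫ y in ball (0 : E) 1, ∑ i, inner ℝ y (b i) * fderiv ℝ W (x + r • y) (b i) := by
        refine integral_congr_ae (ae_of_all _ fun y => ?_)
        dsimp only
        have := congrArg (fderiv ℝ W (x + r • y)) (b.sum_repr' y)
        simp only [map_sum, map_smul, smul_eq_mul] at this
        rw [← this]
        exact Finset.sum_congr rfl fun i _ => by rw [real_inner_comm]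
    _ = ∑ i, ∫ y in ball (0 : E) 1, inner ℝ y (b i) * fderiv ℝ W (x + r • y) (b i) :=
        integral_finsetSum _ fun i _ => hint i
    _ = ∑ i, ∫ y, (r * fderiv ℝ (fderiv ℝ W) (x + r • y) (b i) (b i)) * ballPotential y := by
        simp_rw [key]
    _ = ∫ y, ∑ i, (r * fderiv ℝ (fderiv ℝ W) (x + r • y) (b i) (b i)) * ballPotential y :=
        (integral_finsetSum _ fun i _ => hint2 i).symm
    _ = _ := by
        rw [← integral_const_mul]
        refine integral_congr_ae (ae_of_all _ fun y => ?_)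
        simp only [laplacian_eq_sum_fderiv b, Finset.sum_mul, Finset.mul_sum]
        exact Finset.sum_congr rfl fun i _ => by ring

theorem hasDerivAt_integral_ball_dilation {W : E → ℝ} (hW : ContDiff ℝ 1 W)
    (hc : HasCompactSupport W) (x : E) (r : ℝ) :
    HasDerivAt (fun r : ℝ => ∫ y in ball (0 : E) 1, W (x + r • y))
      (∫ y in ball (0 : E) 1, fderiv ℝ W (x + r • y) y) r := by
  have hDc : Continuous (fderiv ℝ W) := hW.continuous_fderiv one_ne_zero
  obtain ⟨C, hC⟩ := (hc.fderiv ℝ).exists_bound_of_continuous hDc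
  have hC0 : 0 ≤ C := (norm_nonneg _).trans (hC 0)
  have hWc := hW.continuous
  refine (hasDerivAt_integral_of_dominated_loc_of_deriv_le (s := Set.univ) (bound := fun _ => C)
    (F' := fun t y => fderiv ℝ W (x + t • y) y) univ_mem ?_ ?_ ?_ ?_ ?_ ?_).2
  · exact Eventually.of_forall fun t => Continuous.aestronglyMeasurable (by fun_prop)
  · refine IntegrableOn.mono_set (t := closedBall 0 1) ?_ ball_subset_closedBall
    exact ContinuousOn.integrableOn_compact (isCompact_closedBall _ _) (by fun_prop)
  · exact Continuous.aestronglyMeasurable (by fun_prop)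
  · filter_upwards [ae_restrict_mem measurableSet_ball] with y hy t _
    refine ((fderiv ℝ W (x + t • y)).le_opNorm y).trans ?_
    have : ‖y‖ ≤ 1 := by simpa using (mem_ball.1 hy).le
    calc _ ≤ C * 1 := mul_le_mul (hC _) this (norm_nonneg _) hC0
      _ = C := mul_one C
  · have : IsFiniteMeasure ((volume : Measure E).restrict (ball 0 1)) :=
      ⟨by simpa using measure_ball_lt_top⟩
    exact integrable_const C
  · refine ae_of_all _ fun y t _ => ?_
    have h1 : HasDerivAt (fun t : ℝ => x + t • y) y t := by
      simpa using ((hasDerivAt_id t).smul_const y).const_add x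
    exact ((hW.differentiable one_ne_zero) _).hasFDerivAt.comp_hasDerivAt t h1

/-- The mean values over concentric balls of a superharmonic function decrease with the radius: the
derivative in the radius is an integral of the Laplacian against a nonnegative weight. The function
is first multiplied by a cutoff function which is one on the larger of the two balls. -/
theorem antitoneOn_integral_ball_of_laplacian_nonpos {w : E → ℝ} {x : E} {R : ℝ}
    (hw : ContDiffOn ℝ 2 w (ball x R)) (hΔ : ∀ y ∈ ball x R, Δ w y ≤ 0) :
    AntitoneOn (fun r : ℝ => ∫ y in ball (0 : E) 1, w (x + r • y)) (Set.Ico 0 R) := by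
  intro r₁ h₁ r₂ h₂ h12
  rcases h12.eq_or_lt with rfl | hlt
  · exact le_rfl
  have hr₂ : 0 < r₂ := h₁.1.trans_lt hlt
  let χ : ContDiffBump x := ⟨r₂, (r₂ + R) / 2, hr₂, by linarith [h₂.2]⟩
  have hsub : closedBall x ((r₂ + R) / 2) ⊆ ball x R :=
    closedBall_subset_ball (by linarith [h₂.2])
  set W : E → ℝ := fun y => χ y * w y with hWdef
  have hWc : HasCompactSupport W := χ.hasCompactSupport.mul_right
  have hW : ContDiff ℝ 2 W := by
    rw [contDiff_iff_contDiffAt]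
    intro y
    by_cases hy : y ∈ ball x R
    · exact χ.contDiff.contDiffAt.mul (hw.contDiffAt (isOpen_ball.mem_nhds hy))
    · have : W =ᶠ[𝓝 y] fun _ => 0 := by
        have hy' : y ∈ (closedBall x ((r₂ + R) / 2))ᶜ := fun h => hy (hsub h)
        filter_upwards [isClosed_closedBall.isOpen_compl.mem_nhds hy'] with z hz
        have : χ z = 0 := χ.zero_of_le_dist (not_le.1 fun h => hz h).le
        simp [hWdef, this]
      exact contDiffAt_const.congr_of_eventuallyEq this
  have heq : Set.EqOn W w (closedBall x r₂) := fun y hy => by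
    simp [hWdef, χ.one_of_mem_closedBall hy]
  have hmean : ∀ r ∈ Set.Icc 0 r₂, ∫ y in ball (0 : E) 1, W (x + r • y) =
      ∫ y in ball (0 : E) 1, w (x + r • y) := fun r hr =>
    setIntegral_congr_fun measurableSet_ball fun y hy => heq (by
      have : ‖y‖ ≤ 1 := by simpa using (mem_ball.1 hy).le
      simp only [mem_closedBall, dist_self_add_left, norm_smul, Real.norm_eq_abs,
        abs_of_nonneg hr.1]
      nlinarith [hr.1, hr.2])
  have hanti : AntitoneOn (fun r : ℝ => ∫ y in ball (0 : E) 1, W (x + r • y))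
      (Set.Icc 0 r₂) := by
    refine antitoneOn_of_hasDerivWithinAt_nonpos (convex_Icc _ _)
      (f' := fun r => ∫ y in ball (0 : E) 1, fderiv ℝ W (x + r • y) y)
      (fun r _ => (hasDerivAt_integral_ball_dilation
        (hW.of_le one_le_two) hWc x r).continuousAt.continuousWithinAt)
      (fun r _ => (hasDerivAt_integral_ball_dilation
        (hW.of_le one_le_two) hWc x r).hasDerivWithinAt) fun r hr => ?_
    rw [interior_Icc] at hr
    rw [setIntegral_fderiv_apply_self hW hWc]
    refine mul_nonpos_of_nonneg_of_nonpos hr.1.le (integral_nonpos fun y => ?_)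
    by_cases hy : 1 ≤ ‖y‖
    · simp [ballPotential_of_norm_ge hy]
    · refine mul_nonpos_of_nonpos_of_nonneg ?_ (ballPotential_nonneg y)
      have hmem : x + r • y ∈ ball x r₂ := by
        simp only [mem_ball, dist_self_add_left, norm_smul, Real.norm_eq_abs,
          abs_of_nonneg hr.1.le]
        nlinarith [hr.1, hr.2, norm_nonneg y]
      have hev : W =ᶠ[𝓝 (x + r • y)] w := by
        filter_upwards [isOpen_ball.mem_nhds hmem] with z hz
        exact heq (ball_subset_closedBall hz)
      rw [(laplacian_congr_nhds hev).self_of_nhds]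
      exact hΔ _ (ball_subset_ball h₂.2.le hmem)
  have := hanti ⟨h₁.1, h12⟩ ⟨hr₂.le, le_rfl⟩ h12
  simp only at this
  rwa [hmean _ ⟨h₁.1, h12⟩, hmean _ ⟨hr₂.le, le_rfl⟩] at this

end MeanValue

/-! ### Scalar curvature of a conformally flat metric -/

section ConformallyFlat

variable {n : ℕ} {F : EuclideanSpace ℝ (Fin n) → ℝ}

theorem contDiff_pd {k : ℕ∞ω} (hF : ContDiff ℝ (k + 1) F) (i : Fin n) : ContDiff ℝ k (pd i F) :=
  (hF.fderiv_right le_rfl).clm_apply contDiff_const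

theorem pd_congr_of_eq {G : EuclideanSpace ℝ (Fin n) → ℝ} (h : ∀ y, F y = G y) (i : Fin n)
    (y : EuclideanSpace ℝ (Fin n)) : pd i F y = pd i G y := by
  rw [funext h]

theorem pd_exp_const_mul {c : ℝ} (hF : ContDiff ℝ 1 F) (i : Fin n)
    (y : EuclideanSpace ℝ (Fin n)) :
    pd i (fun y => Real.exp (c * F y)) y = Real.exp (c * F y) * (c * pd i F y) := by
  have h := (((hF.differentiable one_ne_zero) y).hasFDerivAt.const_mul c).exp
  simp only [pd, h.fderiv]
  simp

theorem christoffel_conformallyFlat (hF : ContDiff ℝ 1 F) (k i j : Fin n)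
    (y : EuclideanSpace ℝ (Fin n)) :
    christoffel (fun y => Real.exp (2 * F y) • (1 : Matrix (Fin n) (Fin n) ℝ)) k i j y =
      (if k = j then 1 else 0) * pd i F y + (if k = i then 1 else 0) * pd j F y -
        (if i = j then 1 else 0) * pd k F y := by
  have hpd : ∀ a b c : Fin n, pd a (fun z => (Real.exp (2 * F z) •
      (1 : Matrix (Fin n) (Fin n) ℝ)) b c) y =
      (if b = c then 1 else 0) * (Real.exp (2 * F y) * (2 * pd a F y)) := by
    intro a b c
    by_cases h : b = c
    · subst h
      simpa using pd_exp_const_mul (c := 2) hF a y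
    · simp [h, pd]
  have hinv : (Real.exp (2 * F y) • (1 : Matrix (Fin n) (Fin n) ℝ))⁻¹ =
      Real.exp (-(2 * F y)) • (1 : Matrix (Fin n) (Fin n) ℝ) := by
    refine Matrix.inv_eq_left_inv ?_
    rw [smul_mul_smul_comm, one_mul, ← Real.exp_add]
    simp
  have hexp : Real.exp (-(2 * F y)) * Real.exp (2 * F y) = 1 := by
    rw [← Real.exp_add]
    simp
  simp only [christoffel, hpd, hinv]
  rw [Finset.sum_eq_single k]
  · simp only [Matrix.smul_apply, Matrix.one_apply_eq, smul_eq_mul, mul_one, eq_comm (a := j),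
      eq_comm (a := i) (b := k)]
    linear_combination ((if k = j then 1 else 0) * pd i F y + (if k = i then 1 else 0) * pd j F y -
        (if i = j then 1 else 0) * pd k F y) * hexp
  · intro b _ hb
    simp [hb.symm]
  · simp

theorem coordScalarCurvature_conformallyFlat (hF : ContDiff ℝ 2 F)
    (y : EuclideanSpace ℝ (Fin n)) :
    coordScalarCurvature (fun y => Real.exp (2 * F y) • (1 : Matrix (Fin n) (Fin n) ℝ)) y =
      -Real.exp (-(2 * F y)) * (2 * ((n : ℝ) - 1) * ∑ i, pd i (pd i F) y +
        ((n : ℝ) - 1) * (n - 2) * ∑ i, pd i F y ^ 2) := by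
  have hF1 : ContDiff ℝ 1 F := hF.of_le one_le_two
  have hinv : (Real.exp (2 * F y) • (1 : Matrix (Fin n) (Fin n) ℝ))⁻¹ =
      Real.exp (-(2 * F y)) • (1 : Matrix (Fin n) (Fin n) ℝ) := by
    refine Matrix.inv_eq_left_inv ?_
    rw [smul_mul_smul_comm, one_mul, ← Real.exp_add]
    simp
  have hdiff : ∀ i, Differentiable ℝ (pd i F) := fun i =>
    (contDiff_pd (k := 1) hF i).differentiable one_ne_zero
  have hpdΓ : ∀ a k i j : Fin n, pd a
      (christoffel (fun y => Real.exp (2 * F y) • (1 : Matrix (Fin n) (Fin n) ℝ)) k i j) y =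
      (if k = j then 1 else 0) * pd a (pd i F) y + (if k = i then 1 else 0) * pd a (pd j F) y -
        (if i = j then 1 else 0) * pd a (pd k F) y := by
    intro a k i j
    rw [pd_congr_of_eq (christoffel_conformallyFlat hF1 k i j)]
    have h := (((hdiff i y).hasFDerivAt.const_mul (if k = j then (1 : ℝ) else 0)).add
      ((hdiff j y).hasFDerivAt.const_mul (if k = i then (1 : ℝ) else 0))).sub
      ((hdiff k y).hasFDerivAt.const_mul (if i = j then (1 : ℝ) else 0))
    have h' := congrArg (fun L => L (EuclideanSpace.single a 1)) h.fderiv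
    exact h'
  have hric : ∀ i, ricci (fun y => Real.exp (2 * F y) • (1 : Matrix (Fin n) (Fin n) ℝ)) i i y =
      2 * pd i (pd i F) y - ∑ l, pd l (pd l F) y - n * pd i (pd i F) y +
        (-(n - 2) * ∑ l, pd l F y ^ 2 + (n - 2) * pd i F y ^ 2) := by
    intro i
    simp only [ricci, hpdΓ, christoffel_conformallyFlat hF1]
    congr 1
    · simp [Finset.sum_sub_distrib, Finset.sum_add_distrib, ite_mul]
      ring
    · simp [mul_add, add_mul, mul_sub, sub_mul, Finset.sum_sub_distrib, Finset.sum_add_distrib,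
        ite_mul, mul_ite, pow_two]
      ring
  have hsum : coordScalarCurvature
      (fun y => Real.exp (2 * F y) • (1 : Matrix (Fin n) (Fin n) ℝ)) y =
      Real.exp (-(2 * F y)) *
        ∑ i, ricci (fun y => Real.exp (2 * F y) • (1 : Matrix (Fin n) (Fin n) ℝ)) i i y := by
    simp only [coordScalarCurvature, hinv, Finset.mul_sum]
    refine Finset.sum_congr rfl fun i _ => ?_
    rw [Finset.sum_eq_single i]
    · simp
    · intro b _ hb
      simp [hb.symm]
    · simp
  rw [hsum]
  simp only [hric, Finset.sum_add_distrib, Finset.sum_sub_distrib, ← Finset.mul_sum,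
    Finset.sum_const, Finset.card_univ, Fintype.card_fin, nsmul_eq_mul]
  ring

/-- Where the scalar curvature of `e^{2F} δ` is nonnegative, the Laplacian of `e^{(n-2)F/2}` is
nonpositive. -/
theorem sum_pd_pd_exp_nonpos (hn : 3 ≤ n) (hF : ContDiff ℝ 2 F) {y : EuclideanSpace ℝ (Fin n)}
    (h : 0 ≤ coordScalarCurvature
      (fun y => Real.exp (2 * F y) • (1 : Matrix (Fin n) (Fin n) ℝ)) y) :
    ∑ i, pd i (pd i fun y => Real.exp (((n : ℝ) - 2) / 2 * F y)) y ≤ 0 := by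
  have hF1 : ContDiff ℝ 1 F := hF.of_le one_le_two
  have hn' : (3 : ℝ) ≤ n := by exact_mod_cast hn
  have hd : ∀ i, pd i (pd i fun y => Real.exp (((n : ℝ) - 2) / 2 * F y)) y =
      Real.exp (((n : ℝ) - 2) / 2 * F y) * (((n : ℝ) - 2) / 2) *
        (pd i (pd i F) y + ((n : ℝ) - 2) / 2 * pd i F y ^ 2) := by
    intro i
    rw [pd_congr_of_eq (pd_exp_const_mul hF1 i)]
    have h1 := (((hF1.differentiable one_ne_zero) y).hasFDerivAt.const_mul (((n : ℝ) - 2) / 2)).exp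
    have h2 := (((contDiff_pd (k := 1) hF i).differentiable one_ne_zero) y).hasFDerivAt.const_mul
      (((n : ℝ) - 2) / 2)
    have h' := congrArg (fun L => L (EuclideanSpace.single i 1)) (h1.mul h2).fderiv
    simp only [pd] at h' ⊢
    refine h'.trans ?_
    simp
    ring
  simp only [hd, ← Finset.mul_sum, Finset.sum_add_distrib]
  rw [coordScalarCurvature_conformallyFlat hF, neg_mul, neg_nonneg] at h
  have h3 := nonpos_of_mul_nonpos_right h (Real.exp_pos _)
  refine mul_nonpos_of_nonneg_of_nonpos (mul_nonneg (Real.exp_pos _).le (by linarith)) ?_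
  nlinarith

end ConformallyFlat

/-! ### Homogeneous extension and stereographic charts -/

/-- The radial projection `x ↦ x / |x|` onto the sphere, with an arbitrary value at the origin. -/
noncomputable def radialProj {n : ℕ} (x : EuclideanSpace ℝ (Fin (n + 1))) : Sph n :=
  if h : x = 0 then ⟨EuclideanSpace.single 0 1, by simp⟩
  else ⟨‖x‖⁻¹ • x, by simp [norm_smul, h]⟩

/-- The extension of a function on the sphere to a function on the ambient space which is
homogeneous of degree `(2 - n) / 2`. In this degree the Laplacian of the extension restricts to the
conformal Laplacian of the sphere. -/
noncomputable def homExt {n : ℕ} (u : Sph n → ℝ) (x : EuclideanSpace ℝ (Fin (n + 1))) : ℝ :=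
  ‖x‖ ^ ((2 - (n : ℝ)) / 2) * u (radialProj x)

section Geometry

open Metric Laplacian InnerProductSpace

variable {n : ℕ}

theorem coe_radialProj {x : EuclideanSpace ℝ (Fin (n + 1))} (hx : x ≠ 0) :
    (radialProj x : EuclideanSpace ℝ (Fin (n + 1))) = ‖x‖⁻¹ • x := by
  simp [radialProj, hx]

theorem norm_smul_radialProj (x : EuclideanSpace ℝ (Fin (n + 1))) :
    ‖x‖ • (radialProj x : EuclideanSpace ℝ (Fin (n + 1))) = x := by
  by_cases hx : x = 0
  · simp [hx]
  · simp [coe_radialProj hx, smul_smul, hx]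

theorem radialProj_smul {t : ℝ} (ht : 0 < t) (x : EuclideanSpace ℝ (Fin (n + 1))) :
    radialProj (t • x) = radialProj x := by
  by_cases hx : x = 0
  · simp [hx]
  · apply Subtype.ext
    rw [coe_radialProj hx, coe_radialProj (smul_ne_zero ht.ne' hx), norm_smul, Real.norm_eq_abs,
      abs_of_pos ht, smul_smul]
    congr 1
    field_simp

theorem radialProj_coe (p : Sph n) : radialProj (p : EuclideanSpace ℝ (Fin (n + 1))) = p := by
  apply Subtype.ext
  rw [coe_radialProj (ne_zero_of_mem_unit_sphere p)]
  simp

theorem homExt_smul (u : Sph n → ℝ) {t : ℝ} (ht : 0 < t) (x : EuclideanSpace ℝ (Fin (n + 1))) :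
    homExt u (t • x) = t ^ ((2 - (n : ℝ)) / 2) * homExt u x := by
  rw [homExt, homExt, radialProj_smul ht, norm_smul, Real.norm_eq_abs, abs_of_pos ht,
    Real.mul_rpow ht.le (norm_nonneg _), mul_assoc]

/-- The chart of the sphere at `p` is the stereographic projection from `-p`. -/
theorem exists_linearIsometry_chartParam (p : Sph n) :
    ∃ L : EuclideanSpace ℝ (Fin n) →ₗᵢ[ℝ] EuclideanSpace ℝ (Fin (n + 1)),
      (∀ y, inner ℝ (L y) (p : EuclideanSpace ℝ (Fin (n + 1))) = 0) ∧
      ∀ y, chartParam p y = (‖y‖ ^ 2 + 4)⁻¹ • ((4 : ℝ) • L y +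
        (4 - ‖y‖ ^ 2) • (p : EuclideanSpace ℝ (Fin (n + 1)))) := by
  have : Fact (Module.finrank ℝ (EuclideanSpace ℝ (Fin (n + 1))) = n + 1) := ⟨by simp⟩
  let U := (OrthonormalBasis.fromOrthogonalSpanSingleton (𝕜 := ℝ) n
    (ne_zero_of_mem_unit_sphere (-p))).repr
  refine ⟨(Submodule.subtypeₗᵢ _).comp U.symm.toLinearIsometry, fun y => ?_, fun y => ?_⟩
  · have h := (U.symm y).2
    rw [Submodule.mem_orthogonal_singleton_iff_inner_left] at h
    have h' : inner ℝ ((U.symm y : _) : EuclideanSpace ℝ (Fin (n + 1)))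
        (p : EuclideanSpace ℝ (Fin (n + 1))) = 0 := by simpa using h
    exact h'
  · have h := stereographic'_symm_apply (-p) y
    refine h.trans ?_
    have hU : ‖((U.symm y : _) : EuclideanSpace ℝ (Fin (n + 1)))‖ = ‖y‖ := by
      rw [← Submodule.coe_norm, LinearIsometryEquiv.norm_map]
    change (‖((U.symm y : _) : EuclideanSpace ℝ (Fin (n + 1)))‖ ^ 2 + 4)⁻¹ • (4 : ℝ) •
      ((U.symm y : _) : EuclideanSpace ℝ (Fin (n + 1))) +
      (‖((U.symm y : _) : EuclideanSpace ℝ (Fin (n + 1)))‖ ^ 2 + 4)⁻¹ •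
      (‖((U.symm y : _) : EuclideanSpace ℝ (Fin (n + 1)))‖ ^ 2 - (4 : ℝ)) •
      (-p : EuclideanSpace ℝ (Fin (n + 1))) = _
    simp only [hU]
    rw [← smul_add, smul_neg, ← neg_smul, neg_sub]
    rfl

theorem chartAt_self_eq_zero (p : Sph n) : chartAt (EuclideanSpace ℝ (Fin n)) p p = 0 := by
  have : Fact (Module.finrank ℝ (EuclideanSpace ℝ (Fin (n + 1))) = n + 1) := ⟨by simp⟩
  change stereographic' n (-p) p = 0
  have h := stereographic_neg_apply p
  have h2 : stereographic' n (-p) p = (OrthonormalBasis.fromOrthogonalSpanSingleton (𝕜 := ℝ) n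
    (ne_zero_of_mem_unit_sphere (-p))).repr (stereographic (norm_eq_of_mem_sphere (-p)) p) := rfl
  rw [h2, h, map_zero]

theorem contDiff_comp_chartAt_symm {f : Sph n → ℝ} (hf : ContMDiff (𝓡 n) 𝓘(ℝ, ℝ) ∞ f)
    (p : Sph n) : ContDiff ℝ ∞ fun y => f ((chartAt (EuclideanSpace ℝ (Fin n)) p).symm y) := by
  have : Fact (Module.finrank ℝ (EuclideanSpace ℝ (Fin (n + 1))) = n + 1) := ⟨by simp⟩
  have h1 : ContMDiffOn (𝓡 n) (𝓡 n) ∞ (chartAt (EuclideanSpace ℝ (Fin n)) p).symm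
      (chartAt (EuclideanSpace ℝ (Fin n)) p).target := contMDiffOn_chart_symm
  have ht : (chartAt (EuclideanSpace ℝ (Fin n)) p).target = Set.univ :=
    stereographic'_target (-p)
  rw [ht] at h1
  have h2 := hf.comp_contMDiffOn h1
  rw [contMDiffOn_univ] at h2
  exact contMDiff_iff_contDiff.1 h2

theorem contDiffAt_comp_radialProj {f : Sph n → ℝ} (hf : ContMDiff (𝓡 n) 𝓘(ℝ, ℝ) ∞ f)
    {x : EuclideanSpace ℝ (Fin (n + 1))} (hx : x ≠ 0) :
    ContDiffAt ℝ ∞ (fun z => f (radialProj z)) x := by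
  have : Fact (Module.finrank ℝ (EuclideanSpace ℝ (Fin (n + 1))) = n + 1) := ⟨by simp⟩
  set p := radialProj x with hp
  let U := (OrthonormalBasis.fromOrthogonalSpanSingleton (𝕜 := ℝ) n
    (ne_zero_of_mem_unit_sphere (-p))).repr
  have hnorm : ContDiffAt ℝ ∞ (fun z : EuclideanSpace ℝ (Fin (n + 1)) => ‖z‖⁻¹ • z) x :=
    ((contDiffAt_norm ℝ hx).inv (norm_ne_zero_iff.2 hx)).smul contDiffAt_id
  have hpx : ‖x‖⁻¹ • x = (p : EuclideanSpace ℝ (Fin (n + 1))) := (coe_radialProj hx).symm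
  have hne : innerSL ℝ ((-p : Sph n) : EuclideanSpace ℝ (Fin (n + 1))) (‖x‖⁻¹ • x) ≠ 1 := by
    rw [hpx]
    simp
    norm_num
  have hopen : IsOpen {z : EuclideanSpace ℝ (Fin (n + 1)) |
      innerSL ℝ ((-p : Sph n) : EuclideanSpace ℝ (Fin (n + 1))) z ≠ (1 : ℝ)} :=
    isOpen_ne.preimage (innerSL ℝ _).continuous
  have hst : ContDiffAt ℝ ∞ (fun z => U (stereoToFun
      ((-p : Sph n) : EuclideanSpace ℝ (Fin (n + 1))) (‖z‖⁻¹ • z))) x :=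
    U.contDiff.contDiffAt.comp x (ContDiffAt.comp (f := fun z => ‖z‖⁻¹ • z) x
      (contDiffOn_stereoToFun.contDiffAt (hopen.mem_nhds hne)) hnorm)
  refine ((contDiff_comp_chartAt_symm hf p).contDiffAt.comp x hst).congr_of_eventuallyEq ?_
  filter_upwards [isOpen_ne.mem_nhds hx, hnorm.continuousAt.preimage_mem_nhds (hopen.mem_nhds hne)]
    with z hz hz'
  have hmem : radialProj z ∈ (chartAt (EuclideanSpace ℝ (Fin n)) p).source := by
    change radialProj z ∈ (stereographic' n (-p)).source
    rw [stereographic'_source]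
    intro h
    apply hz'
    rw [Set.mem_singleton_iff] at h
    dsimp only
    rw [← coe_radialProj hz, h]
    simp
  have := (chartAt (EuclideanSpace ℝ (Fin n)) p).left_inv hmem
  have h2 : chartAt (EuclideanSpace ℝ (Fin n)) p (radialProj z) =
      U (stereoToFun ((-p : Sph n) : EuclideanSpace ℝ (Fin (n + 1))) (‖z‖⁻¹ • z)) := by
    rw [← coe_radialProj hz]
    rfl
  simp only [Function.comp]
  rw [← h2, this]

theorem contDiffAt_homExt_conformalFactor {f : Sph n → ℝ} (hf : ContMDiff (𝓡 n) 𝓘(ℝ, ℝ) ∞ f)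
    {x : EuclideanSpace ℝ (Fin (n + 1))} (hx : x ≠ 0) :
    ContDiffAt ℝ ∞ (homExt (conformalFactor f)) x :=
  ((contDiffAt_norm ℝ hx).rpow_const_of_ne (norm_ne_zero_iff.2 hx)).mul
    (contDiffAt_const.mul (contDiffAt_comp_radialProj hf hx)).exp

/-- The map `y ↦ p + L y - (|y|² / 4) p`. If `L` is an isometry onto the tangent space at `p`, this
is the inverse stereographic projection scaled by `(4 + |y|²) / 4`. -/
noncomputable def stereoCone (L : EuclideanSpace ℝ (Fin n) →ₗᵢ[ℝ] EuclideanSpace ℝ (Fin (n + 1)))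
    (p : EuclideanSpace ℝ (Fin (n + 1))) (y : EuclideanSpace ℝ (Fin n)) :
    EuclideanSpace ℝ (Fin (n + 1)) :=
  L y + (1 - ‖y‖ ^ 2 / 4) • p

section

variable {L : EuclideanSpace ℝ (Fin n) →ₗᵢ[ℝ] EuclideanSpace ℝ (Fin (n + 1))}
  {p : EuclideanSpace ℝ (Fin (n + 1))}

theorem hasFDerivAt_stereoCone (y : EuclideanSpace ℝ (Fin n)) :
    HasFDerivAt (stereoCone L p) (L.toContinuousLinearMap -
      ((2⁻¹ : ℝ) • innerSL ℝ y).smulRight p) y := by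
  have h := L.toContinuousLinearMap.hasFDerivAt (x := y) |>.add
    ((((hasStrictFDerivAt_norm_sq y).hasFDerivAt.const_mul (4⁻¹ : ℝ)).const_sub 1).smul_const p)
  refine (h.congr_fderiv ?_).congr_of_eventuallyEq (Eventually.of_forall fun z => ?_)
  · ext1 v
    simp
    module
  · simp [stereoCone, div_eq_inv_mul]

theorem norm_stereoCone (hL : ∀ y, inner ℝ (L y) p = 0) (hp : ‖p‖ = 1)
    (y : EuclideanSpace ℝ (Fin n)) : ‖stereoCone L p y‖ = (‖y‖ ^ 2 + 4) / 4 := by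
  have h : ‖stereoCone L p y‖ ^ 2 = ((‖y‖ ^ 2 + 4) / 4) ^ 2 := by
    rw [stereoCone, norm_add_sq_real, inner_smul_right, hL, norm_smul, L.norm_map, hp,
      Real.norm_eq_abs, mul_one, sq_abs]
    ring
  exact (pow_left_inj₀ (norm_nonneg _) (by positivity) two_ne_zero).1 h

theorem stereoCone_ne_zero (hL : ∀ y, inner ℝ (L y) p = 0) (hp : ‖p‖ = 1)
    (y : EuclideanSpace ℝ (Fin n)) : stereoCone L p y ≠ 0 := by
  rw [← norm_ne_zero_iff, norm_stereoCone hL hp]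
  positivity

/-- The inverse stereographic projection is conformal with factor `4 / (4 + |y|²)`. -/
theorem inner_fderiv_stereo (hL : ∀ y, inner ℝ (L y) p = 0) (hp : ‖p‖ = 1)
    (y v w : EuclideanSpace ℝ (Fin n)) :
    inner ℝ (fderiv ℝ (fun y => (4 * (‖y‖ ^ 2 + 4)⁻¹ : ℝ) • stereoCone L p y) y v)
      (fderiv ℝ (fun y => (4 * (‖y‖ ^ 2 + 4)⁻¹ : ℝ) • stereoCone L p y) y w) =
      (4 / (4 + ‖y‖ ^ 2)) ^ 2 * inner ℝ v w := by
  have hpos : (‖y‖ ^ 2 + 4) ≠ 0 := by positivity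
  have h1 := ((hasDerivAt_inv hpos).comp_hasFDerivAt y
    ((hasStrictFDerivAt_norm_sq y).hasFDerivAt.add_const 4)).const_mul 4
  have h2 := (h1.smul (hasFDerivAt_stereoCone (L := L) (p := p) y)).fderiv
  have h3 : ∀ v, fderiv ℝ (fun y => (4 * (‖y‖ ^ 2 + 4)⁻¹ : ℝ) • stereoCone L p y) y v =
      (4 * (‖y‖ ^ 2 + 4)⁻¹ : ℝ) • (L v - (2⁻¹ * inner ℝ y v) • p) -
      (8 * ((‖y‖ ^ 2 + 4) ^ 2)⁻¹ * inner ℝ y v : ℝ) • (L y + (1 - ‖y‖ ^ 2 / 4) • p) := by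
    intro v
    refine (congrArg (fun M => M v) h2).trans ?_
    simp [stereoCone]
    module
  have hpL : ∀ y, inner ℝ p (L y) = 0 := fun y => by rw [real_inner_comm, hL]
  have hpp : inner ℝ p p = (1 : ℝ) := by rw [real_inner_self_eq_norm_sq, hp, one_pow]
  rw [h3, h3]
  simp only [inner_sub_left, inner_sub_right, inner_add_left, inner_add_right, inner_smul_left,
    inner_smul_right, hL, hpL, hpp, L.inner_map_map, real_inner_self_eq_norm_sq,
    RCLike.conj_to_real, real_inner_comm y v]
  rw [add_comm (4 : ℝ)]
  field_simp
  ring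

/-- Along the scaled stereographic chart, the second derivatives of a function which is
homogeneous of degree `(2 - n) / 2` add up to its Laplacian. -/
theorem sum_pd_pd_comp_stereoCone (hL : ∀ y, inner ℝ (L y) p = 0) (hp : ‖p‖ = 1)
    {w : EuclideanSpace ℝ (Fin (n + 1)) → ℝ} (hw : ∀ x ≠ 0, ContDiffAt ℝ 2 w x)
    (hhom : ∀ t : ℝ, 0 < t → w (t • p) = t ^ ((2 - (n : ℝ)) / 2) * w p) :
    ∑ i, pd i (pd i fun y => w (stereoCone L p y)) 0 = Δ w p := by
  set d : ℝ := (2 - (n : ℝ)) / 2 with hd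
  have hp0 : p ≠ 0 := norm_ne_zero_iff.1 (by rw [hp]; exact one_ne_zero)
  have hdiff : ∀ x ≠ 0, DifferentiableAt ℝ w x := fun x hx => (hw x hx).differentiableAt two_ne_zero
  have hdiff2 : ∀ x ≠ 0, DifferentiableAt ℝ (fderiv ℝ w) x := fun x hx =>
    ((hw x hx).fderiv_right (m := 1) le_rfl).differentiableAt one_ne_zero
  have hγ0 : stereoCone L p 0 = p := by simp [stereoCone]
  -- Euler's identities
  have hray : ∀ t : ℝ, HasDerivAt (fun t : ℝ => t • p) p t := fun t => by
    simpa using (hasDerivAt_id t).smul_const p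
  have euler1 : ∀ t : ℝ, 0 < t → fderiv ℝ w (t • p) p = d * t ^ (d - 1) * w p := by
    intro t ht
    have h1 := (hdiff _ (smul_ne_zero ht.ne' hp0)).hasFDerivAt.comp_hasDerivAt t (hray t)
    have h2 : HasDerivAt (fun t : ℝ => t ^ d * w p) (d * t ^ (d - 1) * w p) t :=
      (Real.hasDerivAt_rpow_const (Or.inl ht.ne')).mul_const _
    refine h1.unique (h2.congr_of_eventuallyEq ?_)
    filter_upwards [isOpen_Ioi.mem_nhds ht] with s hs
    exact hhom s hs
  have euler2 : fderiv ℝ (fderiv ℝ w) p p p = d * (d - 1) * w p := by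
    have h1 : HasDerivAt (fun t : ℝ => fderiv ℝ w (t • p) p) (fderiv ℝ (fderiv ℝ w) p p p) 1 := by
      have h := (hdiff2 ((1 : ℝ) • p) (by simpa using hp0)).hasFDerivAt.comp_hasDerivAt 1 (hray 1)
      rw [one_smul] at h
      simpa using h.clm_apply (hasDerivAt_const (1 : ℝ) p)
    have h2 : HasDerivAt (fun t : ℝ => d * t ^ (d - 1) * w p) (d * (d - 1) * w p) 1 := by
      have h := ((Real.hasDerivAt_rpow_const (x := 1) (p := d - 1)
        (Or.inl one_ne_zero)).const_mul d).mul_const (w p)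
      simpa [mul_assoc] using h
    refine h1.unique (h2.congr_of_eventuallyEq ?_)
    filter_upwards [isOpen_Ioi.mem_nhds (zero_lt_one' ℝ)] with s hs
    exact euler1 s hs
  have hpd1 : ∀ i y, pd i (fun y => w (stereoCone L p y)) y =
      fderiv ℝ w (stereoCone L p y) (L (EuclideanSpace.single i 1) - (2⁻¹ * y i) • p) := by
    intro i y
    have h := ((hdiff _ (stereoCone_ne_zero hL hp y)).hasFDerivAt.comp y
      (hasFDerivAt_stereoCone y)).fderiv
    refine (congrArg (fun M => M (EuclideanSpace.single i 1)) h).trans ?_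
    simp [EuclideanSpace.inner_single_right]
  have hpd2 : ∀ i, pd i (pd i fun y => w (stereoCone L p y)) 0 =
      fderiv ℝ (fderiv ℝ w) p (L (EuclideanSpace.single i 1)) (L (EuclideanSpace.single i 1)) -
        2⁻¹ * fderiv ℝ w p p := by
    intro i
    rw [pd_congr_of_eq (hpd1 i)]
    have h1 := HasFDerivAt.comp (0 : EuclideanSpace ℝ (Fin n))
      (hdiff2 _ (stereoCone_ne_zero hL hp 0)).hasFDerivAt (hasFDerivAt_stereoCone (L := L) 0)
    have h2 : HasFDerivAt (fun y : EuclideanSpace ℝ (Fin n) =>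
        L (EuclideanSpace.single i 1) - (2⁻¹ * y i) • p)
        (0 - ((2⁻¹ : ℝ) • EuclideanSpace.proj (𝕜 := ℝ) i).smulRight p) 0 :=
      (hasFDerivAt_const _ _).sub
        (((EuclideanSpace.proj (𝕜 := ℝ) i).hasFDerivAt.const_mul (2⁻¹ : ℝ)).smul_const p)
    have h := (h1.clm_apply h2).fderiv
    refine (congrArg (fun M => M (EuclideanSpace.single i 1)) h).trans ?_
    simp [hγ0]
    ring
  -- an orthonormal basis consisting of `p` and the images of the coordinate vectors
  let v : Fin (n + 1) → EuclideanSpace ℝ (Fin (n + 1)) :=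
    Fin.cons p fun i => L (EuclideanSpace.single i 1)
  have hv : Orthonormal ℝ v := by
    rw [orthonormal_iff_ite]
    intro i j
    refine Fin.cases ?_ (fun i => ?_) i <;> refine Fin.cases ?_ (fun j => ?_) j
    · simp [v, hp]
    · simp [v, real_inner_comm _ p, hL, (Fin.succ_ne_zero j).symm]
    · simp [v, hL]
    · simp [v, L.inner_map_map, EuclideanSpace.inner_single_left]
  let b : OrthonormalBasis (Fin (n + 1)) ℝ (EuclideanSpace ℝ (Fin (n + 1))) :=
    (basisOfOrthonormalOfCardEqFinrank hv (by simp)).toOrthonormalBasis (by simpa using hv)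
  have hb : ∀ i, b i = v i := fun i => by simp [b]
  rw [laplacian_eq_sum_fderiv b, Fin.sum_univ_succ]
  simp only [hb, v, Fin.cons_zero, Fin.cons_succ, hpd2, Finset.sum_sub_distrib, Finset.sum_const,
    Finset.card_univ, Fintype.card_fin, nsmul_eq_mul, euler2]
  have e1 := euler1 1 one_pos
  rw [one_smul, Real.one_rpow] at e1
  rw [e1, hd]
  ring

end

/-- In the stereographic chart the conformal metric is conformally flat. -/
theorem conformalMetric_eq (f : Sph n → ℝ) (p : Sph n) :
    conformalMetric f p = fun y => Real.exp
      (2 * (f ((chartAt (EuclideanSpace ℝ (Fin n)) p).symm y) + Real.log (4 / (4 + ‖y‖ ^ 2)))) •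
      (1 : Matrix (Fin n) (Fin n) ℝ) := by
  obtain ⟨L, hL, hchart⟩ := exists_linearIsometry_chartParam p
  have hp : ‖(p : EuclideanSpace ℝ (Fin (n + 1)))‖ = 1 := norm_eq_of_mem_sphere p
  have hσ : chartParam p = fun y => (4 * (‖y‖ ^ 2 + 4)⁻¹ : ℝ) •
      stereoCone L (p : EuclideanSpace ℝ (Fin (n + 1))) y := by
    funext y
    rw [hchart, stereoCone]
    module
  funext y
  ext i j
  have hpos : 0 < 4 / (4 + ‖y‖ ^ 2) := by positivity
  rw [conformalMetric, Matrix.of_apply, hσ, inner_fderiv_stereo hL hp, mul_add, Real.exp_add,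
    mul_comm 2 (Real.log _), Real.exp_mul (Real.log _), Real.exp_log hpos, Matrix.smul_apply,
    smul_eq_mul, mul_assoc]
  congr 2
  · norm_cast
  · simp [EuclideanSpace.inner_single_left, Matrix.one_apply]

/-- On the sphere, the Laplacian of the homogeneous extension is the flat Laplacian of the conformal
factor with respect to the Euclidean metric of the stereographic chart: the extension takes the
value of this conformal factor at the corresponding point of the scaled chart `stereoCone`. -/
theorem laplacian_homExt_coe_nonpos (hn : 3 ≤ n) {f : Sph n → ℝ}
    (hf : ContMDiff (𝓡 n) 𝓘(ℝ, ℝ) ∞ f) {p : Sph n} (hSc : 0 ≤ scalarCurvature f p) :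
    Δ (homExt (conformalFactor f)) (p : EuclideanSpace ℝ (Fin (n + 1))) ≤ 0 := by
  obtain ⟨L, hL, hchart⟩ := exists_linearIsometry_chartParam p
  have hp : ‖(p : EuclideanSpace ℝ (Fin (n + 1)))‖ = 1 := norm_eq_of_mem_sphere p
  rw [← sum_pd_pd_comp_stereoCone hL hp
    (fun x hx => (contDiffAt_homExt_conformalFactor hf hx).of_le (by norm_cast))
    (fun t ht => homExt_smul _ ht _)]
  have hU : (fun y => homExt (conformalFactor f)
      (stereoCone L (p : EuclideanSpace ℝ (Fin (n + 1))) y)) =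
      fun y => Real.exp (((n : ℝ) - 2) / 2 *
        (f ((chartAt (EuclideanSpace ℝ (Fin n)) p).symm y) + Real.log (4 / (4 + ‖y‖ ^ 2)))) := by
    funext y
    have hpos : 0 < 4 / (4 + ‖y‖ ^ 2) := by positivity
    have hproj : radialProj (stereoCone L (p : EuclideanSpace ℝ (Fin (n + 1))) y) =
        (chartAt (EuclideanSpace ℝ (Fin n)) p).symm y := by
      apply Subtype.ext
      rw [coe_radialProj (stereoCone_ne_zero hL hp y), norm_stereoCone hL hp]
      refine Eq.trans ?_ (hchart y).symm
      rw [stereoCone, inv_div, div_eq_mul_inv]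
      module
    rw [homExt, hproj, norm_stereoCone hL hp, conformalFactor, mul_add, Real.exp_add,
      mul_comm _ (Real.log _), Real.exp_mul (Real.log _), Real.exp_log hpos, mul_comm]
    congr 1
    rw [show (‖y‖ ^ 2 + 4) / 4 = (4 / (4 + ‖y‖ ^ 2))⁻¹ by rw [inv_div, add_comm],
      Real.inv_rpow hpos.le, ← Real.rpow_neg hpos.le]
    congr 1
    ring
  rw [hU]
  refine sum_pd_pd_exp_nonpos hn
    (F := fun y => f ((chartAt (EuclideanSpace ℝ (Fin n)) p).symm y) +
      Real.log (4 / (4 + ‖y‖ ^ 2))) ?_ ?_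
  · refine ((contDiff_comp_chartAt_symm hf p).of_le (by norm_cast)).add ?_
    refine ContDiff.log (contDiff_const.div (contDiff_const.add (contDiff_norm_sq ℝ)) ?_) ?_
    all_goals
      intro y
      positivity
  · rwa [scalarCurvature, conformalMetric_eq, chartAt_self_eq_zero] at hSc

theorem fderiv_smul_comp_smul {E G : Type*} [NormedAddCommGroup E] [NormedSpace ℝ E]
    [NormedAddCommGroup G] [NormedSpace ℝ G] (c s : ℝ) (g : E → G) (x : E) :
    fderiv ℝ (fun z => c • g (s • z)) x = (c * s) • fderiv ℝ g (s • x) := by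
  refine (congrFun (fderiv_const_smul_field (𝕜 := ℝ) (f := fun z => g (s • z)) c) x).trans ?_
  rw [Pi.smul_apply, fderiv_comp_smul, smul_smul]

/-- If the scalar curvature of `e^{2f} g₀` is nonnegative, the homogeneous extension of its
conformal factor is superharmonic away from the origin. -/
theorem laplacian_homExt_nonpos (hn : 3 ≤ n) {f : Sph n → ℝ}
    (hf : ContMDiff (𝓡 n) 𝓘(ℝ, ℝ) ∞ f) (hSc : ∀ p, 0 ≤ scalarCurvature f p)
    {x : EuclideanSpace ℝ (Fin (n + 1))} (hx : x ≠ 0) :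
    Δ (homExt (conformalFactor f)) x ≤ 0 := by
  set w := homExt (conformalFactor f)
  set t := ‖x‖ with ht
  have ht0 : 0 < t := norm_pos_iff.2 hx
  have hw : w = fun z => t ^ ((2 - (n : ℝ)) / 2) • w (t⁻¹ • z) := by
    funext z
    rw [smul_eq_mul, ← homExt_smul _ ht0, smul_smul, mul_inv_cancel₀ ht0.ne', one_smul]
  have hD : fderiv ℝ w = fun z => (t ^ ((2 - (n : ℝ)) / 2) * t⁻¹) • fderiv ℝ w (t⁻¹ • z) := by
    funext z
    conv_lhs => rw [hw]
    exact fderiv_smul_comp_smul _ _ _ _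
  have hDD : fderiv ℝ (fderiv ℝ w) x =
      (t ^ ((2 - (n : ℝ)) / 2) * t⁻¹ * t⁻¹) • fderiv ℝ (fderiv ℝ w) (t⁻¹ • x) := by
    conv_lhs => rw [hD]
    exact fderiv_smul_comp_smul _ _ (fderiv ℝ w) x
  have hp := laplacian_homExt_coe_nonpos hn hf (hSc (radialProj x))
  rw [coe_radialProj hx] at hp
  rw [laplacian_eq_sum_fderiv (stdOrthonormalBasis ℝ _)] at hp ⊢
  rw [hDD]
  simp only [smul_apply, smul_eq_mul, ← Finset.mul_sum]
  exact mul_nonpos_of_nonneg_of_nonpos (by positivity) hp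

end Geometry

/-! ### Polar coordinates -/

/-- The extension of a function `U` with values in `[0, ∞]` to the ambient space, homogeneous of
degree `(2 - n) / 2`. -/
noncomputable def lhomExt {n : ℕ} (U : Sph n → ℝ≥0∞) (x : EuclideanSpace ℝ (Fin (n + 1))) : ℝ≥0∞ :=
  ENNReal.ofReal (‖x‖ ^ ((2 - (n : ℝ)) / 2)) * U (radialProj x)

section Polar

open Metric

variable {n : ℕ}

instance isFiniteMeasure_roundVol : IsFiniteMeasure (roundVol n) := by
  unfold roundVol
  infer_instance

theorem measurable_radialProj :
    Measurable (radialProj : EuclideanSpace ℝ (Fin (n + 1)) → Sph n) := by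
  rw [← (MeasurableEmbedding.subtype_coe isClosed_sphere.measurableSet).measurable_comp_iff]
  have h : (Subtype.val ∘ (radialProj : EuclideanSpace ℝ (Fin (n + 1)) → Sph n)) =
      fun x => if x = 0 then EuclideanSpace.single 0 1 else ‖x‖⁻¹ • x := by
    funext x
    by_cases hx : x = 0 <;> simp [radialProj, hx]
  rw [h]
  exact Measurable.ite (measurableSet_singleton 0) measurable_const (by fun_prop)

theorem measurable_lhomExt {U : Sph n → ℝ≥0∞} (hU : Measurable U) : Measurable (lhomExt U) :=
  (by fun_prop : Measurable fun x : EuclideanSpace ℝ (Fin (n + 1)) =>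
    ENNReal.ofReal (‖x‖ ^ ((2 - (n : ℝ)) / 2))).mul (hU.comp measurable_radialProj)

theorem lhomExt_smul (U : Sph n → ℝ≥0∞) {t : ℝ} (ht : 0 < t)
    (x : EuclideanSpace ℝ (Fin (n + 1))) :
    lhomExt U (t • x) = ENNReal.ofReal (t ^ ((2 - (n : ℝ)) / 2)) * lhomExt U x := by
  rw [lhomExt, lhomExt, radialProj_smul ht, norm_smul, Real.norm_eq_abs, abs_of_pos ht,
    Real.mul_rpow ht.le (norm_nonneg _), ENNReal.ofReal_mul (by positivity), mul_assoc]

theorem lhomExt_coe (U : Sph n → ℝ≥0∞) (p : Sph n) : lhomExt U p = U p := by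
  simp [lhomExt, radialProj_coe]

theorem ofReal_homExt (u : Sph n → ℝ) (x : EuclideanSpace ℝ (Fin (n + 1))) :
    ENNReal.ofReal (homExt u x) = lhomExt (fun p => ENNReal.ofReal (u p)) x := by
  rw [homExt, lhomExt, ENNReal.ofReal_mul (by positivity)]

theorem lintegral_norm_mul_radialProj {h : ℝ → ℝ≥0∞} (hh : Measurable h) {g : Sph n → ℝ≥0∞}
    (hg : Measurable g) :
    ∫⁻ x : EuclideanSpace ℝ (Fin (n + 1)), h ‖x‖ * g (radialProj x) =
      (∫⁻ r in Set.Ioi (0 : ℝ), h r * ENNReal.ofReal (r ^ n)) * ∫⁻ p, g p ∂roundVol n := by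
  let E := EuclideanSpace ℝ (Fin (n + 1))
  have hmp := (volume : Measure E).measurePreserving_homeomorphUnitSphereProd
  have h1 : ∫⁻ x : E, h ‖x‖ * g (radialProj x) =
      ∫⁻ x : ({(0 : E)}ᶜ : Set E), h ‖(x : E)‖ * g (radialProj (x : E))
        ∂((volume : Measure E).comap (↑)) := by
    rw [lintegral_subtype_comap (measurableSet_singleton _).compl
      (fun x : E => h ‖x‖ * g (radialProj x)), restrict_compl_singleton]
  have h2 : ∫⁻ x : ({(0 : E)}ᶜ : Set E), h ‖(x : E)‖ * g (radialProj (x : E))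
        ∂((volume : Measure E).comap (↑)) =
      ∫⁻ z : Sph n × Set.Ioi (0 : ℝ), g z.1 * h z.2
        ∂((roundVol n).prod (Measure.volumeIoiPow (Module.finrank ℝ E - 1))) := by
    rw [roundVol, ← hmp.lintegral_comp_emb (Homeomorph.measurableEmbedding _)]
    refine lintegral_congr fun x => ?_
    have hx : (x : E) ≠ 0 := x.2
    have hfst : (homeomorphUnitSphereProd E x).1 = radialProj (x : E) := by
      apply Subtype.ext
      rw [coe_radialProj hx]
      simp
    rw [hfst, mul_comm]
    simp
  rw [h1, h2, lintegral_prod_mul (g := fun r : Set.Ioi (0 : ℝ) => h r) hg.aemeasurable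
    (hh.comp measurable_subtype_coe).aemeasurable, mul_comm]
  congr 1
  have hfin : Module.finrank ℝ E - 1 = n := by simp [E]
  rw [hfin, Measure.volumeIoiPow, lintegral_withDensity_eq_lintegral_mul _ (by fun_prop)
    (g := fun r : Set.Ioi (0 : ℝ) => h r) (hh.comp measurable_subtype_coe)]
  rw [← lintegral_subtype_comap measurableSet_Ioi (fun r : ℝ => h r * ENNReal.ofReal (r ^ n))]
  exact lintegral_congr fun r => mul_comm _ _

/-- The radial factor of the integral of a homogeneous extension over a part of a shell. -/
noncomputable def radialMass (n : ℕ) (a b : ℝ) : ℝ≥0∞ :=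
  ∫⁻ r in Set.Ioo a b, ENNReal.ofReal (r ^ ((2 - (n : ℝ)) / 2)) * ENNReal.ofReal (r ^ n)

/-- The part over `S` of the shell between the radii `a` and `b`. -/
def sector (S : Set (Sph n)) (a b : ℝ) : Set (EuclideanSpace ℝ (Fin (n + 1))) :=
  {x | ‖x‖ ∈ Set.Ioo a b ∧ radialProj x ∈ S}

theorem measurableSet_sector {S : Set (Sph n)} (hS : MeasurableSet S) (a b : ℝ) :
    MeasurableSet (sector S a b) :=
  (measurable_norm measurableSet_Ioo).inter (measurable_radialProj hS)

theorem setLIntegral_sector {S : Set (Sph n)} (hS : MeasurableSet S) {a b : ℝ} (ha : 0 ≤ a)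
    {h : ℝ → ℝ≥0∞} (hh : Measurable h) {g : Sph n → ℝ≥0∞} (hg : Measurable g) :
    ∫⁻ x in sector S a b, h ‖x‖ * g (radialProj x) =
      (∫⁻ r in Set.Ioo a b, h r * ENNReal.ofReal (r ^ n)) * ∫⁻ p in S, g p ∂roundVol n := by
  rw [← lintegral_indicator (measurableSet_sector hS a b), ← lintegral_indicator hS]
  have h1 : ∀ x : EuclideanSpace ℝ (Fin (n + 1)),
      (sector S a b).indicator (fun x => h ‖x‖ * g (radialProj x)) x =
      (Set.Ioo a b).indicator h ‖x‖ * S.indicator g (radialProj x) := by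
    intro x
    by_cases h1 : ‖x‖ ∈ Set.Ioo a b <;> by_cases h2 : radialProj x ∈ S <;>
      simp [sector, Set.indicator, h1, h2] <;> simp_all
  rw [lintegral_congr h1, lintegral_norm_mul_radialProj (hh.indicator measurableSet_Ioo)
    (hg.indicator hS), ← lintegral_indicator measurableSet_Ioo,
    ← lintegral_indicator measurableSet_Ioi]
  congr 1
  refine lintegral_congr fun r => ?_
  by_cases h1 : r ∈ Set.Ioo a b
  · have : r ∈ Set.Ioi (0 : ℝ) := ha.trans_lt h1.1
    simp [h1, this]
  · by_cases h2 : r ∈ Set.Ioi (0 : ℝ) <;> simp [h1, h2]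

theorem setLIntegral_sector_lhomExt {S : Set (Sph n)} (hS : MeasurableSet S) {a b : ℝ}
    (ha : 0 ≤ a) {U : Sph n → ℝ≥0∞} (hU : Measurable U) :
    ∫⁻ x in sector S a b, lhomExt U x = radialMass n a b * ∫⁻ p in S, U p ∂roundVol n :=
  setLIntegral_sector hS ha (h := fun r => ENNReal.ofReal (r ^ ((2 - (n : ℝ)) / 2)))
    (by fun_prop) hU

theorem volume_sector {S : Set (Sph n)} (hS : MeasurableSet S) {a b : ℝ} (ha : 0 ≤ a) :
    volume (sector S a b) = (∫⁻ r in Set.Ioo a b, ENNReal.ofReal (r ^ n)) * roundVol n S := by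
  simpa using setLIntegral_sector hS ha (b := b) (h := fun _ => 1) measurable_const
    (g := fun _ => 1) measurable_const

theorem radialMass_ne_top {a b : ℝ} (ha : 0 ≤ a) : radialMass n a b ≠ ⊤ := by
  refine ne_top_of_le_ne_top (b := ∫⁻ r in Set.Ioo a b, ENNReal.ofReal (b ^ (((n : ℝ) + 2) / 2)))
    ?_ (setLIntegral_mono measurable_const fun r hr => ?_)
  · rw [setLIntegral_const]
    exact ENNReal.mul_ne_top ENNReal.ofReal_ne_top measure_Ioo_lt_top.ne
  · have hr0 : 0 < r := ha.trans_lt hr.1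
    rw [← ENNReal.ofReal_mul (by positivity), ← Real.rpow_natCast, ← Real.rpow_add hr0]
    refine ENNReal.ofReal_le_ofReal ?_
    rw [show (2 - (n : ℝ)) / 2 + n = ((n : ℝ) + 2) / 2 by ring]
    exact Real.rpow_le_rpow hr0.le hr.2.le (by positivity)

theorem radialMass_pos {a b : ℝ} (ha : 0 ≤ a) (hab : a < b) : radialMass n a b ≠ 0 := by
  rw [radialMass, Ne, setLIntegral_eq_zero_iff measurableSet_Ioo (by fun_prop)]
  intro h
  have h2 : ∀ᵐ r : ℝ, r ∉ Set.Ioo a b := by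
    filter_upwards [h] with r hr hmem
    have hr0 : 0 < r := ha.trans_lt hmem.1
    have := hr hmem
    simp only [mul_eq_zero, ENNReal.ofReal_eq_zero, not_le.2 (Real.rpow_pos_of_pos hr0 _),
      not_le.2 (pow_pos hr0 _), or_self] at this
  rw [ae_iff] at h2
  simp only [not_not] at h2
  have := (Measure.measure_Ioo_pos (volume : Measure ℝ)).2 hab
  exact this.ne' h2

/-- A property of directions holds almost everywhere in the ambient space if and only if it holds
almost everywhere on the sphere. -/
theorem ae_radialProj_iff {P : Sph n → Prop} (hP : MeasurableSet {p | P p}) :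
    (∀ᵐ x : EuclideanSpace ℝ (Fin (n + 1)), P (radialProj x)) ↔ ∀ᵐ p ∂roundVol n, P p := by
  have h := lintegral_norm_mul_radialProj (n := n) (h := fun _ => 1) measurable_const
    (g := {p | P p}ᶜ.indicator fun _ => 1) (measurable_const.indicator hP.compl)
  have hpre : ∫⁻ x : EuclideanSpace ℝ (Fin (n + 1)),
      1 * {p | P p}ᶜ.indicator (fun _ => (1 : ℝ≥0∞)) (radialProj x) =
      volume {x : EuclideanSpace ℝ (Fin (n + 1)) | ¬ P (radialProj x)} := by
    refine Eq.trans ?_ (lintegral_indicator_one (measurable_radialProj hP.compl))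
    exact lintegral_congr fun x => by by_cases h : P (radialProj x) <;> simp [h]
  rw [hpre, lintegral_indicator_const hP.compl, one_mul] at h
  have hrad : ∫⁻ r in Set.Ioi (0 : ℝ), 1 * ENNReal.ofReal (r ^ n) ≠ 0 := by
    rw [Ne, setLIntegral_eq_zero_iff measurableSet_Ioi (by fun_prop)]
    intro h
    have h2 : ∀ᵐ r : ℝ, r ∉ Set.Ioi (0 : ℝ) := by
      filter_upwards [h] with r hr hmem
      have := hr hmem
      simp [not_le.2 (pow_pos (Set.mem_Ioi.1 hmem) n)] at this
    have h3 : volume (Set.Ioi (0 : ℝ)) = 0 := by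
      rw [ae_iff] at h2
      simp only [not_not] at h2
      exact h2
    rw [Real.volume_Ioi] at h3
    exact ENNReal.top_ne_zero h3
  rw [ae_iff, ae_iff, h, mul_eq_zero, or_iff_right hrad]
  rfl

end Polar

/-! ### Functions with decreasing ball means -/

section SuperMean

open Metric Laplacian

variable {E : Type*} [NormedAddCommGroup E] [InnerProductSpace ℝ E] [FiniteDimensional ℝ E]
  [MeasurableSpace E] [BorelSpace E]

/-- The mean value of `V` over the ball of radius `r` about `x`. -/
noncomputable def ballMean (V : E → ℝ≥0∞) (x : E) (r : ℝ) : ℝ≥0∞ :=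
  ⨍⁻ y in ball x r, V y ∂volume

/-- `V` has decreasing means over the concentric balls that do not meet the origin. This is the
form of superharmonicity on the punctured space that survives passage to `L¹` limits. -/
def IsSuperMean (V : E → ℝ≥0∞) : Prop := ∀ x ≠ 0, AntitoneOn (ballMean V x) (Set.Ioo 0 ‖x‖)

/-- The pointwise representative of a function with decreasing ball means. -/
noncomputable def lscReg (V : E → ℝ≥0∞) (x : E) : ℝ≥0∞ := ⨆ r ∈ Set.Ioo 0 ‖x‖, ballMean V x r

theorem volume_ball_pos {x : E} {r : ℝ} (hr : 0 < r) : volume (ball x r) ≠ 0 :=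
  (measure_ball_pos _ _ hr).ne'

theorem volume_ball_ne_top {x : E} {r : ℝ} : volume (ball x r) ≠ ⊤ := measure_ball_lt_top.ne

theorem ballMean_eq_div (V : E → ℝ≥0∞) (x : E) (r : ℝ) :
    ballMean V x r = (∫⁻ y in ball x r, V y) / volume (ball x r) := by
  rw [ballMean, setLAverage_eq]

theorem setLIntegral_ball_eq (V : E → ℝ≥0∞) (x : E) {r : ℝ} (hr : 0 < r) :
    ∫⁻ y in ball x r, V y =
      ENNReal.ofReal (r ^ Module.finrank ℝ E) * ∫⁻ y in ball (0 : E) 1, V (x + r • y) := by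
  let e : E ≃ᵐ E :=
    ((Homeomorph.smulOfNeZero r hr.ne').trans (Homeomorph.addLeft x)).toMeasurableEquiv
  have he : ∀ y, e y = x + r • y := fun _ => rfl
  have hmap : Measure.map e volume = ENNReal.ofReal |(r ^ Module.finrank ℝ E)⁻¹| • volume := by
    have h1 : Measure.map e volume =
        Measure.map (x + ·) (Measure.map (r • ·) (volume : Measure E)) := by
      rw [Measure.map_map (by fun_prop) (by fun_prop)]
      rfl
    rw [h1, Measure.map_addHaar_smul _ hr.ne', Measure.map_smul, map_add_left_eq_self]
  have hpre : e ⁻¹' ball x r = ball 0 1 := by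
    ext y
    simp [he, norm_smul, abs_of_pos hr, hr]
  have h2 := lintegral_map_equiv (μ := volume.restrict (ball (0 : E) 1)) V e
  rw [← hpre, ← MeasurableEquiv.restrict_map, hmap, Measure.restrict_smul, lintegral_smul_measure,
    smul_eq_mul, hpre] at h2
  simp only [he] at h2
  rw [← h2, ← mul_assoc, ← ENNReal.ofReal_mul (by positivity), abs_of_pos (by positivity),
    mul_inv_cancel₀ (by positivity), ENNReal.ofReal_one, one_mul]

theorem ballMean_eq (V : E → ℝ≥0∞) (x : E) {r : ℝ} (hr : 0 < r) :
    ballMean V x r = (∫⁻ y in ball (0 : E) 1, V (x + r • y)) / volume (ball (0 : E) 1) := by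
  have h1 : volume (ball x r) = ENNReal.ofReal (r ^ Module.finrank ℝ E) * volume (ball (0 : E) 1) :=
    Measure.addHaar_ball_of_pos _ _ hr
  rw [ballMean_eq_div, setLIntegral_ball_eq V x hr, h1, ENNReal.mul_div_mul_left _ _
    (by simpa using pow_pos hr _) ENNReal.ofReal_ne_top]

section Smooth

variable {w : E → ℝ}

theorem integrableOn_comp_dilation (hw : ∀ x ≠ 0, ContDiffAt ℝ 2 w x) {x : E} {r : ℝ}
    (hr : r ∈ Set.Ico 0 ‖x‖) :
    IntegrableOn (fun y => w (x + r • y)) (ball 0 1) := by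
  refine IntegrableOn.mono_set (t := closedBall 0 1) ?_ ball_subset_closedBall
  refine ContinuousOn.integrableOn_compact (isCompact_closedBall _ _) fun y hy => ?_
  have hne : x + r • y ≠ 0 := by
    intro h
    have h1 : ‖x‖ = r * ‖y‖ := by
      rw [eq_neg_of_add_eq_zero_left h, norm_neg, norm_smul, Real.norm_eq_abs, abs_of_nonneg hr.1]
    have h2 : ‖y‖ ≤ 1 := by simpa using hy
    nlinarith [hr.1, hr.2]
  exact (ContinuousAt.comp (f := fun y => x + r • y) (hw _ hne).continuousAt
    (by fun_prop)).continuousWithinAt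

theorem antitoneOn_integral_dilation (hw : ∀ x ≠ 0, ContDiffAt ℝ 2 w x)
    (hΔ : ∀ x ≠ 0, Δ w x ≤ 0) {x : E} :
    AntitoneOn (fun r : ℝ => ∫ y in ball (0 : E) 1, w (x + r • y)) (Set.Ico 0 ‖x‖) := by
  have hne : ∀ y ∈ ball x ‖x‖, y ≠ 0 := by
    rintro y hy rfl
    simp at hy
  exact antitoneOn_integral_ball_of_laplacian_nonpos
    (fun y hy => (hw y (hne y hy)).contDiffWithinAt) fun y hy => hΔ y (hne y hy)

theorem ballMean_ofReal (hw0 : ∀ x, 0 ≤ w x) (hw : ∀ x ≠ 0, ContDiffAt ℝ 2 w x)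
    {x : E} {r : ℝ} (hr : r ∈ Set.Ioo 0 ‖x‖) :
    ballMean (fun y => ENNReal.ofReal (w y)) x r =
      ENNReal.ofReal (∫ y in ball (0 : E) 1, w (x + r • y)) / volume (ball (0 : E) 1) := by
  rw [ballMean_eq _ _ hr.1, ofReal_integral_eq_lintegral_ofReal
    (integrableOn_comp_dilation hw ⟨hr.1.le, hr.2⟩) (ae_of_all _ fun _ => hw0 _)]

theorem isSuperMean_ofReal (hw0 : ∀ x, 0 ≤ w x) (hw : ∀ x ≠ 0, ContDiffAt ℝ 2 w x)
    (hΔ : ∀ x ≠ 0, Δ w x ≤ 0) : IsSuperMean fun y => ENNReal.ofReal (w y) := by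
  intro x _ r hr s hs hrs
  rw [ballMean_ofReal hw0 hw hr, ballMean_ofReal hw0 hw hs]
  exact ENNReal.div_le_div_right (ENNReal.ofReal_le_ofReal (antitoneOn_integral_dilation hw hΔ
    ⟨hr.1.le, hr.2⟩ ⟨hs.1.le, hs.2⟩ hrs)) _

theorem ballMean_ofReal_le (hw0 : ∀ x, 0 ≤ w x) (hw : ∀ x ≠ 0, ContDiffAt ℝ 2 w x)
    (hΔ : ∀ x ≠ 0, Δ w x ≤ 0) {x : E} {r : ℝ} (hr : r ∈ Set.Ioo 0 ‖x‖) :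
    ballMean (fun y => ENNReal.ofReal (w y)) x r ≤ ENNReal.ofReal (w x) := by
  rw [ballMean_ofReal hw0 hw hr]
  refine ENNReal.div_le_of_le_mul ?_
  have h := antitoneOn_integral_dilation hw hΔ ⟨le_rfl, hr.1.trans hr.2⟩ ⟨hr.1.le, hr.2⟩ hr.1.le
  refine (ENNReal.ofReal_le_ofReal h).trans ?_
  simp only [zero_smul, add_zero, setIntegral_const, smul_eq_mul]
  rw [ENNReal.ofReal_mul measureReal_nonneg, measureReal_def,
    ENNReal.ofReal_toReal volume_ball_ne_top, mul_comm]

end Smooth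

/-- Decreasing ball means are preserved under local `L¹` convergence. -/
theorem IsSuperMean.of_tendsto {V : E → ℝ≥0∞} {W e : ℕ → E → ℝ≥0∞} (hW : ∀ j, IsSuperMean (W j))
    (he : ∀ j, Measurable (e j)) (h1 : ∀ j x, V x ≤ W j x + e j x) (h2 : ∀ j x, W j x ≤ V x + e j x)
    (hlim : ∀ R, Tendsto (fun j => ∫⁻ x in ball 0 R, e j x) atTop (𝓝 0)) : IsSuperMean V := by
  intro x hx r hr s hs hrs
  have hmean : ∀ t ∈ Set.Ioo 0 ‖x‖, Tendsto (fun j => ballMean (e j) x t) atTop (𝓝 0) := by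
    intro t ht
    simp only [ballMean_eq_div]
    have hsub : ball x t ⊆ ball 0 (2 * ‖x‖) :=
      ball_subset_ball' (by rw [dist_zero_right]; linarith [ht.2])
    have h0 : Tendsto (fun j => ∫⁻ y in ball x t, e j y) atTop (𝓝 0) :=
      tendsto_of_tendsto_of_tendsto_of_le_of_le tendsto_const_nhds (hlim (2 * ‖x‖))
        (fun _ => zero_le) fun j => lintegral_mono_set hsub
    simpa using ENNReal.Tendsto.div_const h0 (Or.inr (volume_ball_pos ht.1))
  have hadd : ∀ (A : E → ℝ≥0∞) (j : ℕ) (t : ℝ),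
      ballMean (fun y => A y + e j y) x t = ballMean A x t + ballMean (e j) x t := fun A j t => by
    simp only [ballMean_eq_div]
    rw [lintegral_add_right _ (he j), ENNReal.add_div]
  have hmono : ∀ {A B : E → ℝ≥0∞} (t : ℝ), (∀ y, A y ≤ B y) → ballMean A x t ≤ ballMean B x t :=
    fun t h => by
      simp only [ballMean_eq_div]
      gcongr
      exact h _
  have hlim' : Tendsto (fun j => ballMean V x r + ballMean (e j) x r + ballMean (e j) x s) atTop
      (𝓝 (ballMean V x r)) := by
    simpa using (tendsto_const_nhds.add (hmean r hr)).add (hmean s hs)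
  refine ge_of_tendsto' hlim' fun j => ?_
  calc ballMean V x s ≤ ballMean (W j) x s + ballMean (e j) x s := by
        rw [← hadd]
        exact hmono s (h1 j)
    _ ≤ ballMean (W j) x r + ballMean (e j) x s := by
        gcongr
        exact hW j x hx hr hs hrs
    _ ≤ _ := by
        gcongr
        rw [← hadd]
        exact hmono r (h2 j)

theorem IsSuperMean.tendsto_ballMean {V : E → ℝ≥0∞} (hV : IsSuperMean V) {x : E} (hx : x ≠ 0) :
    Tendsto (ballMean V x) (𝓝[>] 0) (𝓝 (lscReg V x)) := by
  have hx' : 0 < ‖x‖ := norm_pos_iff.2 hx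
  refine tendsto_order.2 ⟨fun c hc => ?_, fun c hc => ?_⟩
  · obtain ⟨r, hr, hcr⟩ : ∃ r ∈ Set.Ioo 0 ‖x‖, c < ballMean V x r := by
      simpa [lscReg, lt_iSup_iff] using hc
    filter_upwards [Ioo_mem_nhdsGT hr.1] with s hs
    exact hcr.trans_le (hV x hx ⟨hs.1, hs.2.trans hr.2⟩ hr hs.2.le)
  · filter_upwards [Ioo_mem_nhdsGT hx'] with s hs
    exact (le_iSup₂ (f := fun r (_ : r ∈ Set.Ioo 0 ‖x‖) => ballMean V x r) s hs).trans_lt hc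

theorem lowerSemicontinuousAt_lscReg (V : E → ℝ≥0∞) (x : E) :
    LowerSemicontinuousAt (lscReg V) x := by
  intro c hc
  obtain ⟨r, hr, hcr⟩ : ∃ r ∈ Set.Ioo 0 ‖x‖, c < ballMean V x r := by
    simpa [lscReg, lt_iSup_iff] using hc
  -- exhaust the ball by smaller concentric balls, which are contained in the balls about
  -- neighbouring points
  have hunion : ball x r = ⋃ k : ℕ, ball x (r - 1 / ((k : ℝ) + 1)) := by
    ext y
    simp only [mem_ball, Set.mem_iUnion]
    refine ⟨fun h => ?_, fun ⟨k, hk⟩ => hk.trans (by simpa using by positivity)⟩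
    obtain ⟨k, hk⟩ := exists_nat_one_div_lt (sub_pos.2 h)
    exact ⟨k, by linarith⟩
  have hdir : Directed (· ⊆ ·) fun k : ℕ => ball x (r - 1 / ((k : ℝ) + 1)) :=
    directed_of_isDirected_le fun a b hab =>
      ball_subset_ball (sub_le_sub_left (one_div_le_one_div_of_le (by positivity) (by gcongr)) _)
  rw [ballMean_eq_div, hunion, setLIntegral_iUnion_of_directed V hdir, ← hunion,
    ENNReal.iSup_div, lt_iSup_iff] at hcr
  obtain ⟨k, hk⟩ := hcr
  have hδ : (0 : ℝ) < 1 / ((k : ℝ) + 1) := by positivity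
  have hnorm : ∀ᶠ y in 𝓝 x, r < ‖y‖ := continuous_norm.continuousAt.eventually_const_lt hr.2
  filter_upwards [hnorm, ball_mem_nhds x hδ] with y hy hyx
  refine hk.trans_le (le_trans ?_ (le_iSup₂ (f := fun r (_ : r ∈ Set.Ioo 0 ‖y‖) => ballMean V y r)
    r ⟨hr.1, hy⟩))
  rw [ballMean_eq_div, Measure.addHaar_ball_center volume x r,
    Measure.addHaar_ball_center volume y r]
  refine ENNReal.div_le_div_right (lintegral_mono_set (ball_subset_ball' ?_)) _
  rw [dist_comm]
  linarith [mem_ball.1 hyx]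

/-- The ball means converge almost everywhere by Lebesgue's differentiation theorem. -/
theorem IsSuperMean.lscReg_ae_eq [Nontrivial E] {V : E → ℝ≥0∞} (hV : IsSuperMean V)
    (hVm : Measurable V) (hVi : ∀ R, ∫⁻ x in ball 0 R, V x ≠ ⊤) : lscReg V =ᵐ[volume] V := by
  have h1 : ∀ R : ℕ, ∀ᵐ x : E, Tendsto (fun a => (∫⁻ y in a, (ball 0 (R : ℝ)).indicator V y) /
      volume a) ((Besicovitch.vitaliFamily (volume : Measure E)).filterAt x)
      (𝓝 ((ball 0 (R : ℝ)).indicator V x)) := fun R =>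
    VitaliFamily.ae_tendsto_lintegral_div _ (hVm.indicator measurableSet_ball).aemeasurable
      (by rw [lintegral_indicator measurableSet_ball]; exact hVi R)
  have h0 : ∀ᵐ x : E, x ≠ 0 := by simp [ae_iff]
  filter_upwards [ae_all_iff.2 h1, h0] with x hx hx0
  obtain ⟨R, hR⟩ := exists_nat_gt ‖x‖
  have h2 := (hx R).comp (Besicovitch.tendsto_filterAt volume x)
  have hxR : x ∈ ball (0 : E) R := by simpa using hR
  rw [Set.indicator_of_mem hxR] at h2
  refine tendsto_nhds_unique (hV.tendsto_ballMean hx0) (h2.congr' ?_)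
  filter_upwards [Ioo_mem_nhdsGT (sub_pos.2 hR)] with r hr
  have hsub : closedBall x r ⊆ ball 0 R := closedBall_subset_ball' (by
    rw [dist_zero_right]
    linarith [hr.2])
  have hae : ball x r =ᵐ[volume] closedBall x r := by
    refine ball_subset_closedBall.eventuallyLE.antisymm (ae_le_set.2 ?_)
    rw [closedBall_sdiff_ball]
    exact Measure.addHaar_sphere _ _ _
  simp only [Function.comp]
  rw [setLIntegral_congr_fun measurableSet_closedBall fun y hy =>
    Set.indicator_of_mem (hsub hy) V, ballMean_eq_div, setLIntegral_congr hae, measure_congr hae]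

/-- The minimum principle: a nonnegative function with decreasing ball means whose
representative vanishes somewhere is zero. -/
theorem IsSuperMean.lscReg_eq_zero (hE : 1 < Module.rank ℝ E) {V : E → ℝ≥0∞} (hV : IsSuperMean V)
    {x₀ : E} (hx₀ : x₀ ≠ 0) (h₀ : lscReg V x₀ = 0) {y : E} (hy : y ≠ 0) :
    lscReg V y = 0 := by
  have key : ∀ x, lscReg V x = 0 → ∀ y ∈ ball x ‖x‖, lscReg V y = 0 := by
    intro x hx y hy
    have hy0 : y ≠ 0 := by
      rintro rfl
      simp at hy
    have hd : 0 < ‖x‖ - dist y x := sub_pos.2 hy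
    refine tendsto_nhds_unique (hV.tendsto_ballMean hy0) (tendsto_const_nhds.congr' ?_)
    filter_upwards [Ioo_mem_nhdsGT (half_pos hd)] with r hr
    have hρ : dist y x + r ∈ Set.Ioo 0 ‖x‖ :=
      ⟨by linarith [hr.1, dist_nonneg (x := y) (y := x)], by linarith [hr.2]⟩
    have hmean : ballMean V x (dist y x + r) = 0 :=
      le_antisymm ((le_iSup₂ (f := fun r (_ : r ∈ Set.Ioo 0 ‖x‖) => ballMean V x r) _ hρ).trans
        hx.le) zero_le
    rw [ballMean_eq_div, ENNReal.div_eq_zero_iff, or_iff_left volume_ball_ne_top] at hmean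
    have : ∫⁻ z in ball y r, V z = 0 :=
      le_antisymm ((lintegral_mono_set (ball_subset_ball' (by rw [add_comm]))).trans hmean.le)
        zero_le
    rw [ballMean_eq_div, this, ENNReal.zero_div]
  set Z : Set E := {x | x ≠ 0 ∧ lscReg V x = 0}
  have hopen : IsOpen Z := by
    rw [isOpen_iff_mem_nhds]
    rintro x ⟨hx, hx'⟩
    filter_upwards [ball_mem_nhds x (norm_pos_iff.2 hx)] with y hy
    refine ⟨?_, key x hx' y hy⟩
    rintro rfl
    simp at hy
  have hsub : ({0}ᶜ : Set E) ⊆ Z := by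
    refine (isConnected_compl_singleton_of_one_lt_rank hE 0).isPreconnected
      |>.subset_of_closure_inter_subset hopen ⟨x₀, hx₀, hx₀, h₀⟩ ?_
    rintro z ⟨hz, hz0⟩
    have hz0' : z ≠ 0 := hz0
    obtain ⟨x, hx, hxz⟩ := Metric.mem_closure_iff.1 hz (‖z‖ / 2) (half_pos (norm_pos_iff.2 hz0'))
    refine ⟨hz0', key x hx.2 z ?_⟩
    rw [mem_ball]
    have h1 : ‖z‖ ≤ ‖x‖ + dist z x := by
      rw [dist_eq_norm]
      simpa using norm_add_le x (z - x)
    linarith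
  exact (hsub hy).2

end SuperMean

/-! ### Means over geodesic balls -/

section Spherical

open Metric

variable {n : ℕ} {U : Sph n → ℝ≥0∞}

theorem setLIntegral_ball_zero_le (hU : Measurable U) (R : ℝ) :
    ∫⁻ x in ball 0 R, lhomExt U x ≤ radialMass n 0 R * ∫⁻ p, U p ∂roundVol n := by
  have h := setLIntegral_sector_lhomExt (S := Set.univ) MeasurableSet.univ le_rfl (b := R) hU
  rw [Measure.restrict_univ] at h
  rw [← h]
  refine lintegral_mono' (Measure.restrict_mono_ae ?_) le_rfl
  have h0 : ∀ᵐ x : EuclideanSpace ℝ (Fin (n + 1)), x ≠ 0 := by simp [ae_iff]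
  filter_upwards [h0] with x hx hxR
  exact ⟨⟨norm_pos_iff.2 hx, mem_ball_zero_iff.1 hxR⟩, Set.mem_univ _⟩

theorem lscReg_lhomExt_smul (hV : IsSuperMean (lhomExt U)) {t : ℝ} (ht : 0 < t)
    {x : EuclideanSpace ℝ (Fin (n + 1))} (hx : x ≠ 0) :
    lscReg (lhomExt U) (t • x) =
      ENNReal.ofReal (t ^ ((2 - (n : ℝ)) / 2)) * lscReg (lhomExt U) x := by
  have h1 := ENNReal.Tendsto.const_mul (hV.tendsto_ballMean hx)
    (Or.inr (ENNReal.ofReal_ne_top (r := t ^ ((2 - (n : ℝ)) / 2))))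
  have hmul : Tendsto (fun r => t * r) (𝓝[>] 0) (𝓝[>] 0) := by
    refine tendsto_nhdsWithin_iff.2 ⟨?_, ?_⟩
    · have : Tendsto (fun r => t * r) (𝓝 0) (𝓝 (t * 0)) :=
        (continuous_const.mul continuous_id).tendsto 0
      rw [mul_zero] at this
      exact this.mono_left nhdsWithin_le_nhds
    · filter_upwards [self_mem_nhdsWithin] with r hr
      exact mul_pos ht hr
  refine tendsto_nhds_unique ((hV.tendsto_ballMean (smul_ne_zero ht.ne' hx)).comp hmul)
    (h1.congr' ?_)
  filter_upwards [self_mem_nhdsWithin] with r hr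
  have hr0 : 0 < r := hr
  simp only [Function.comp]
  rw [ballMean_eq _ _ hr0, ballMean_eq _ _ (mul_pos ht hr0), ← mul_div_assoc,
    ← lintegral_const_mul' _ _ ENNReal.ofReal_ne_top]
  congr 1
  refine lintegral_congr fun y => ?_
  rw [← lhomExt_smul U ht, smul_add, smul_smul]

/-- The pointwise representative of a function on the sphere whose homogeneous extension has
decreasing ball means. -/
noncomputable def sphReg (U : Sph n → ℝ≥0∞) (p : Sph n) : ℝ≥0∞ := lscReg (lhomExt U) p

theorem lowerSemicontinuous_sphReg (U : Sph n → ℝ≥0∞) : LowerSemicontinuous (sphReg U) :=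
  fun p => (lowerSemicontinuousAt_lscReg (lhomExt U) p).comp continuous_subtype_val.continuousAt

theorem sphReg_ae_eq (hV : IsSuperMean (lhomExt U)) (hU : Measurable U)
    (hUi : ∫⁻ p, U p ∂roundVol n ≠ ⊤) : sphReg U =ᵐ[roundVol n] U := by
  have h1 := hV.lscReg_ae_eq (measurable_lhomExt hU) fun R => ne_top_of_le_ne_top
    (ENNReal.mul_ne_top (radialMass_ne_top le_rfl) hUi) (setLIntegral_ball_zero_le hU R)
  have hm : MeasurableSet {p | sphReg U p = U p} :=
    measurableSet_eq_fun (lowerSemicontinuous_sphReg U).measurable hU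
  refine (ae_radialProj_iff hm).1 ?_
  have h0 : ∀ᵐ x : EuclideanSpace ℝ (Fin (n + 1)), x ≠ 0 := by simp [ae_iff]
  filter_upwards [h1, h0] with x hx hx0
  have hpos : 0 < ‖x‖ := norm_pos_iff.2 hx0
  rw [← norm_smul_radialProj x, lscReg_lhomExt_smul hV hpos
    (ne_zero_of_mem_unit_sphere (radialProj x)), lhomExt_smul _ hpos, lhomExt_coe] at hx
  exact (ENNReal.mul_right_inj (by simpa using Real.rpow_pos_of_pos hpos _)
    ENNReal.ofReal_ne_top).1 hx

theorem sphReg_pos (hn : 1 ≤ n) (hV : IsSuperMean (lhomExt U)) (hU : Measurable U)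
    (hUi : ∫⁻ p, U p ∂roundVol n ≠ ⊤) (hU0 : ∫⁻ p, U p ∂roundVol n ≠ 0) (p : Sph n) :
    0 < sphReg U p := by
  refine pos_iff_ne_zero.2 fun hp => hU0 ?_
  have hrank : 1 < Module.rank ℝ (EuclideanSpace ℝ (Fin (n + 1))) := by
    rw [← Module.finrank_eq_rank, finrank_euclideanSpace_fin]
    exact_mod_cast Nat.lt_succ_of_le hn
  rw [lintegral_eq_zero_iff hU]
  filter_upwards [sphReg_ae_eq hV hU hUi] with q hq
  rw [← hq]
  exact hV.lscReg_eq_zero hrank (ne_zero_of_mem_unit_sphere p) hp (ne_zero_of_mem_unit_sphere q)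

theorem geodBall_eq (x : Sph n) (s : ℝ) :
    geodBall x s =
      {y : Sph n | Real.arccos (inner ℝ (x : EuclideanSpace ℝ (Fin (n + 1))) y) < s} := by
  ext y
  simp [geodBall, InnerProductGeometry.angle]

theorem isOpen_geodBall (x : Sph n) (s : ℝ) : IsOpen (geodBall x s) := by
  rw [geodBall_eq]
  exact isOpen_lt (Real.continuous_arccos.comp (by fun_prop)) continuous_const

/-- The law of cosines, relating the chord to the geodesic distance. -/
theorem norm_sub_sq_eq_two_sub_cos (x y : Sph n) :
    ‖(y : EuclideanSpace ℝ (Fin (n + 1))) - x‖ ^ 2 =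
      2 - 2 * Real.cos (Real.arccos (inner ℝ (x : EuclideanSpace ℝ (Fin (n + 1))) y)) := by
  have h := abs_real_inner_le_norm (x : EuclideanSpace ℝ (Fin (n + 1))) y
  rw [norm_eq_of_mem_sphere, norm_eq_of_mem_sphere, mul_one, abs_le] at h
  rw [Real.cos_arccos h.1 h.2, norm_sub_sq_real, norm_eq_of_mem_sphere, norm_eq_of_mem_sphere,
    real_inner_comm]
  ring

theorem geodBall_subset_ball (x : Sph n) (s : ℝ) : geodBall x s ⊆ ball x s := by
  intro y hy
  rw [geodBall_eq] at hy
  have hs : Real.arccos (inner ℝ (x : EuclideanSpace ℝ (Fin (n + 1))) y) < s := hy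
  have h0 := Real.arccos_nonneg (inner ℝ (x : EuclideanSpace ℝ (Fin (n + 1))) y)
  rw [mem_ball, Subtype.dist_eq, dist_eq_norm]
  refine lt_of_le_of_lt (abs_le_of_sq_le_sq' ?_ h0).2 hs
  rw [norm_sub_sq_eq_two_sub_cos]
  linarith [Real.one_sub_sq_div_two_le_cos
    (x := Real.arccos (inner ℝ (x : EuclideanSpace ℝ (Fin (n + 1))) y))]

theorem ball_subset_geodBall (x : Sph n) (s : ℝ) : ball x (s / 2) ⊆ geodBall x s := by
  intro y hy
  rw [geodBall_eq]
  set θ := Real.arccos (inner ℝ (x : EuclideanSpace ℝ (Fin (n + 1))) y) with hθ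
  have h0 : 0 ≤ θ := Real.arccos_nonneg _
  have hπ : θ ≤ Real.pi := Real.arccos_le_pi _
  rw [mem_ball, Subtype.dist_eq, dist_eq_norm] at hy
  have h1 := norm_sub_sq_eq_two_sub_cos x y
  rw [← hθ] at h1
  have h2 : Real.cos θ ≤ 1 - 2 / Real.pi ^ 2 * θ ^ 2 :=
    Real.cos_le_one_sub_mul_cos_sq (abs_le.2 ⟨by linarith [Real.pi_pos], hπ⟩)
  have hpi : 1 / 4 ≤ 4 / Real.pi ^ 2 / 1 := by
    rw [div_one, div_le_div_iff₀ (by norm_num) (by positivity)]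
    nlinarith [Real.pi_pos, Real.pi_le_four]
  have h3 : θ ^ 2 / 4 ≤ ‖(y : EuclideanSpace ℝ (Fin (n + 1))) - x‖ ^ 2 := by
    rw [h1]
    have : θ ^ 2 / 4 ≤ 4 / Real.pi ^ 2 * θ ^ 2 := by nlinarith [sq_nonneg θ]
    have h4 : 4 / Real.pi ^ 2 * θ ^ 2 = 2 * (2 / Real.pi ^ 2 * θ ^ 2) := by ring
    linarith
  have h4 : θ ≤ 2 * ‖(y : EuclideanSpace ℝ (Fin (n + 1))) - x‖ :=
    (abs_le_of_sq_le_sq' (by nlinarith) (by positivity)).2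
  show θ < s
  linarith

theorem sector_geodBall_subset (x : Sph n) {s : ℝ} (hs1 : s ≤ 1) :
    sector (geodBall x s) (1 - s) 1 ⊆ ball (x : EuclideanSpace ℝ (Fin (n + 1))) (2 * s) := by
  rintro y ⟨hy1, hy2⟩
  have h2 := geodBall_subset_ball x s hy2
  rw [mem_ball, Subtype.dist_eq] at h2
  have h1 : dist y (radialProj y : EuclideanSpace ℝ (Fin (n + 1))) < s := by
    conv_lhs => rw [← norm_smul_radialProj y]
    rw [radialProj_smul (by linarith [hy1.1]), radialProj_coe, dist_eq_norm]
    have : ‖y‖ • (radialProj y : EuclideanSpace ℝ (Fin (n + 1))) - radialProj y =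
        (‖y‖ - 1) • (radialProj y : EuclideanSpace ℝ (Fin (n + 1))) := by module
    rw [this, norm_smul, norm_eq_of_mem_sphere, mul_one, Real.norm_eq_abs, abs_lt]
    constructor <;> linarith [hy1.1, hy1.2]
  rw [mem_ball]
  linarith [dist_triangle y (radialProj y : EuclideanSpace ℝ (Fin (n + 1))) x]

theorem ball_subset_sector_geodBall (x : Sph n) {s : ℝ} (hs0 : 0 < s) (hs1 : s ≤ 1 / 2) :
    ball ((1 - s / 2) • (x : EuclideanSpace ℝ (Fin (n + 1)))) (s / 8) ⊆
      sector (geodBall x s) (1 - s) 1 := by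
  intro y hy
  have hx : ‖(1 - s / 2) • (x : EuclideanSpace ℝ (Fin (n + 1)))‖ = 1 - s / 2 := by
    rw [norm_smul, norm_eq_of_mem_sphere, mul_one, Real.norm_eq_abs, abs_of_pos (by linarith)]
  rw [mem_ball, dist_eq_norm] at hy
  have h1 : |‖y‖ - (1 - s / 2)| < s / 8 := by
    rw [← hx]
    exact (abs_norm_sub_norm_le _ _).trans_lt hy
  obtain ⟨h1a, h1b⟩ := abs_lt.1 h1
  refine ⟨⟨by linarith, by linarith⟩, ball_subset_geodBall x s ?_⟩
  rw [mem_ball, Subtype.dist_eq, dist_eq_norm]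
  have h2 : ‖y‖ • ((radialProj y : EuclideanSpace ℝ (Fin (n + 1))) - x) =
      (y - (1 - s / 2) • (x : EuclideanSpace ℝ (Fin (n + 1)))) +
        ((1 - s / 2) - ‖y‖) • (x : EuclideanSpace ℝ (Fin (n + 1))) := by
    rw [smul_sub, norm_smul_radialProj]
    module
  have h3 := congrArg norm h2
  rw [norm_smul, norm_norm] at h3
  have h4 := norm_add_le (y - (1 - s / 2) • (x : EuclideanSpace ℝ (Fin (n + 1))))
    (((1 - s / 2) - ‖y‖) • (x : EuclideanSpace ℝ (Fin (n + 1))))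
  rw [← h3, norm_smul, norm_eq_of_mem_sphere, mul_one, Real.norm_eq_abs, abs_sub_comm] at h4
  by_contra! hcon
  nlinarith

/-- The sector over a small geodesic ball fills a fixed proportion of a surrounding ball: it
contains a ball of a sixteenth of the radius. -/
theorem volume_ball_le_sector (x : Sph n) {s : ℝ} (hs0 : 0 < s) (hs1 : s ≤ 1 / 2) :
    volume (ball (x : EuclideanSpace ℝ (Fin (n + 1))) (2 * s)) ≤
      16 ^ (n + 1) * volume (sector (geodBall x s) (1 - s) 1) := by
  refine le_trans ?_ (mul_le_mul_right (measure_mono (ball_subset_sector_geodBall x hs0 hs1)) _)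
  rw [Measure.addHaar_ball_center volume ((1 - s / 2) • (x : EuclideanSpace ℝ (Fin (n + 1)))),
    Measure.addHaar_ball_center volume (x : EuclideanSpace ℝ (Fin (n + 1))),
    show 2 * s = 16 * (s / 8) by ring, Measure.addHaar_ball_mul_of_pos _ _ (by norm_num)]
  simp

theorem roundVol_geodBall_pos (x : Sph n) {s : ℝ} (hs : 0 < s) : roundVol n (geodBall x s) ≠ 0 := by
  have : (roundVol n).IsOpenPosMeasure := by
    unfold roundVol
    infer_instance
  refine ((isOpen_geodBall x s).measure_pos _ ⟨x, ball_subset_geodBall x s ?_⟩).ne'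
  simpa using hs

theorem eventually_geodBall_subset (x : Sph n) {O : Set (Sph n)} (hO : O ∈ 𝓝 x) :
    ∀ᶠ s in 𝓝[>] (0 : ℝ), geodBall x s ⊆ O := by
  obtain ⟨δ, hδ, hsub⟩ := Metric.mem_nhds_iff.1 hO
  filter_upwards [Ioo_mem_nhdsGT hδ] with s hs
  exact (geodBall_subset_ball x s).trans ((ball_subset_ball hs.2.le).trans hsub)

/-- At a point where the representative is finite, it bounds the means over small geodesic balls.
The function is at least `sphReg U x - η` near `x` by semicontinuity, so the excess of its mean over
a Euclidean ball controls its mean over any comparable subset, such as a sector. -/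
theorem eventually_laverage_geodBall_le (hV : IsSuperMean (lhomExt U)) (hU : Measurable U)
    (hUi : ∫⁻ p, U p ∂roundVol n ≠ ⊤) (hn : 2 ≤ n) (x : Sph n) {m : ℝ≥0∞} (hm : sphReg U x < m) :
    ∀ᶠ s in 𝓝[>] (0 : ℝ), ⨍⁻ y in geodBall x s, U y ∂roundVol n ≤ m := by
  set L := sphReg U x with hL
  have hLtop : L ≠ ⊤ := hm.ne_top
  -- the factor `16 ^ (n + 1)` bounds the volume of the ball relative to that of the sector
  obtain ⟨η, hη0, hηm⟩ : ∃ η : ℝ≥0∞, 0 < η ∧ L + 16 ^ (n + 1) * η ≤ m := by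
    refine ⟨(m - L) / 16 ^ (n + 1), ?_, ?_⟩
    · exact ENNReal.div_pos (tsub_pos_of_lt hm).ne' (by finiteness)
    · rw [ENNReal.mul_div_cancel (by simp) (by finiteness), add_tsub_cancel_of_le hm.le]
  have hae := hV.lscReg_ae_eq (measurable_lhomExt hU) fun R => ne_top_of_le_ne_top
    (ENNReal.mul_ne_top (radialMass_ne_top le_rfl) hUi) (setLIntegral_ball_zero_le hU R)
  have hlow : ∀ᶠ y in 𝓝 (x : EuclideanSpace ℝ (Fin (n + 1))), L - η ≤ lscReg (lhomExt U) y := by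
    rcases eq_or_ne L 0 with h0 | h0
    · simp [h0]
    · refine (lowerSemicontinuousAt_lscReg (lhomExt U) (x : EuclideanSpace ℝ (Fin (n + 1)))
        (L - η) ?_).mono fun y hy => hy.le
      exact ENNReal.sub_lt_self hLtop h0 hη0.ne'
  obtain ⟨δ, hδ, hball⟩ := Metric.mem_nhds_iff.1 hlow
  filter_upwards [Ioo_mem_nhdsGT (half_pos hδ), Ioo_mem_nhdsGT (show (0 : ℝ) < 1 / 4 by norm_num)]
    with s hs hs'
  set S := sector (geodBall x s) (1 - s) 1
  set B := ball (x : EuclideanSpace ℝ (Fin (n + 1))) (2 * s)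
  have hgm : MeasurableSet (geodBall x s) := (isOpen_geodBall x s).measurableSet
  have hSm : MeasurableSet S := measurableSet_sector hgm _ _
  have hSB : S ⊆ B := sector_geodBall_subset x (by linarith [hs'.2])
  have hBtop : volume B ≠ ⊤ := volume_ball_ne_top
  have hup : ∫⁻ y in B, lhomExt U y ≤ L * volume B := by
    have h1 : ballMean (lhomExt U) x (2 * s) ≤ L :=
      le_iSup₂ (f := fun r (_ : r ∈ Set.Ioo 0 ‖(x : EuclideanSpace ℝ (Fin (n + 1)))‖) =>
        ballMean (lhomExt U) x r) (2 * s)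
        ⟨by linarith [hs.1], by rw [norm_eq_of_mem_sphere]; linarith [hs'.2]⟩
    rw [ballMean_eq_div] at h1
    exact (ENNReal.div_le_iff (volume_ball_pos (by linarith [hs.1])) hBtop).1 h1
  have hdn : (L - η) * volume (B \ S) ≤ ∫⁻ y in B \ S, lhomExt U y := by
    rw [← setLIntegral_const]
    refine setLIntegral_mono_ae (measurable_lhomExt hU).aemeasurable ?_
    filter_upwards [hae] with y hy hyB
    rw [← hy]
    exact hball (ball_subset_ball (by linarith [hs.2]) hyB.1)
  have hsplit : volume B = volume S + volume (B \ S) := by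
    rw [← measure_inter_add_sdiff B hSm, Set.inter_eq_right.2 hSB]
  have hsplit' : ∫⁻ y in B, lhomExt U y =
      (∫⁻ y in S, lhomExt U y) + ∫⁻ y in B \ S, lhomExt U y := by
    rw [← lintegral_inter_add_sdiff (lhomExt U) B hSm, Set.inter_eq_right.2 hSB]
  have hdiff_top : volume (B \ S) ≠ ⊤ := ne_top_of_le_ne_top hBtop (measure_mono Set.sdiff_subset)
  have hmain : ∫⁻ y in S, lhomExt U y ≤ (L + 16 ^ (n + 1) * η) * volume S := by
    have hfin : (L - η) * volume (B \ S) ≠ ⊤ :=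
      ENNReal.mul_ne_top (ne_top_of_le_ne_top hLtop tsub_le_self) hdiff_top
    refine (ENNReal.add_le_add_iff_right hfin).1 ?_
    calc (∫⁻ y in S, lhomExt U y) + (L - η) * volume (B \ S)
        ≤ (∫⁻ y in S, lhomExt U y) + ∫⁻ y in B \ S, lhomExt U y := by gcongr
      _ ≤ L * volume B := by rw [← hsplit']; exact hup
      _ = L * volume S + L * volume (B \ S) := by rw [hsplit, mul_add]
      _ ≤ L * volume S + ((L - η) + η) * volume (B \ S) := by
          gcongr
          exact le_tsub_add
      _ = L * volume S + η * volume (B \ S) + (L - η) * volume (B \ S) := by ring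
      _ ≤ L * volume S + η * (16 ^ (n + 1) * volume S) + (L - η) * volume (B \ S) := by
          gcongr
          exact (measure_mono Set.sdiff_subset).trans
            (volume_ball_le_sector x hs.1 (by linarith [hs'.2]))
      _ = _ := by ring
  -- on the sector the radial weight is at least one
  set J := ∫⁻ r in Set.Ioo (1 - s) 1, ENNReal.ofReal (r ^ n)
  have hS0 : volume S ≠ 0 := fun h => by
    have h1 := volume_ball_le_sector x hs.1 (by linarith [hs'.2])
    rw [show volume (sector (geodBall x s) (1 - s) 1) = 0 from h, mul_zero] at h1
    exact volume_ball_pos (by linarith [hs.1]) (le_antisymm h1 zero_le)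
  have hvS : volume S = J * roundVol n (geodBall x s) :=
    volume_sector hgm (by linarith [hs'.2])
  have hJ : J * ∫⁻ p in geodBall x s, U p ∂roundVol n ≤ ∫⁻ y in S, lhomExt U y := by
    rw [setLIntegral_sector_lhomExt hgm (by linarith [hs'.2]) hU]
    gcongr
    refine setLIntegral_mono (by fun_prop) fun r hr => le_mul_of_one_le_left zero_le ?_
    rw [ENNReal.one_le_ofReal]
    have hn' : (2 : ℝ) ≤ n := by exact_mod_cast hn
    exact Real.one_le_rpow_of_pos_of_le_one_of_nonpos (by linarith [hr.1, hs'.2]) hr.2.le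
      (by linarith)
  have hJ0 : J ≠ 0 := fun h => hS0 (by rw [hvS, h, zero_mul])
  have hJtop : J ≠ ⊤ := fun h => by
    rw [h, ENNReal.top_mul (roundVol_geodBall_pos x hs.1)] at hvS
    exact ne_top_of_le_ne_top hBtop (measure_mono hSB) hvS
  have hfinal : ∫⁻ p in geodBall x s, U p ∂roundVol n ≤
      (L + 16 ^ (n + 1) * η) * roundVol n (geodBall x s) := by
    refine (ENNReal.mul_le_mul_iff_right hJ0 hJtop).1 (hJ.trans (hmain.trans_eq ?_))
    rw [hvS]
    ring
  rw [setLAverage_eq]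
  exact ENNReal.div_le_of_le_mul (hfinal.trans (by gcongr))

theorem laverage_rpow_le {α : Type*} [MeasurableSpace α] {μ : Measure α} {s : Set α}
    (h0 : μ s ≠ 0) (hs : μ s ≠ ⊤) {f : α → ℝ≥0∞} (hf : AEMeasurable f μ) {β : ℝ} (hβ0 : 0 < β)
    (hβ1 : β ≤ 1) : ⨍⁻ y in s, f y ^ β ∂μ ≤ (⨍⁻ y in s, f y ∂μ) ^ β := by
  have hprob : IsProbabilityMeasure ((μ s)⁻¹ • μ.restrict s) :=
    ⟨by simp [ENNReal.inv_mul_cancel h0 hs]⟩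
  have h := eLpNorm'_le_eLpNorm'_of_exponent_le hβ0 hβ1
    (μ := (μ s)⁻¹ • μ.restrict s) (f := f) (hf.restrict.smul_measure _).aestronglyMeasurable
  simp only [eLpNorm', enorm_eq_self, ENNReal.rpow_one, div_one] at h
  rw [one_div, ENNReal.rpow_inv_le_iff hβ0] at h
  simpa [laverage, Measure.restrict_apply_univ] using h

/-- The means of the power `β ≤ 1` over geodesic balls converge everywhere to the power of the
representative: the lower bound is semicontinuity, the upper bound is Jensen's inequality. -/
theorem tendsto_laverage_geodBall (hV : IsSuperMean (lhomExt U)) (hU : Measurable U)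
    (hUi : ∫⁻ p, U p ∂roundVol n ≠ ⊤) (hn : 2 ≤ n) {β : ℝ} (hβ0 : 0 < β) (hβ1 : β ≤ 1)
    (x : Sph n) :
    Tendsto (fun s : ℝ => ⨍⁻ y in geodBall x s, U y ^ β ∂roundVol n) (𝓝[>] 0)
      (𝓝 (sphReg U x ^ β)) := by
  refine tendsto_order.2 ⟨fun c hc => ?_, fun c hc => ?_⟩
  · obtain ⟨c', hcc', hc'⟩ := exists_between hc
    rw [← ENNReal.rpow_inv_lt_iff hβ0] at hc'
    filter_upwards [eventually_geodBall_subset x (lowerSemicontinuous_sphReg U x _ hc'),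
      self_mem_nhdsWithin] with s hs hs0
    refine hcc'.trans_le ?_
    rw [setLAverage_eq, ENNReal.le_div_iff_mul_le (Or.inl (roundVol_geodBall_pos x hs0))
      (Or.inl (measure_ne_top _ _)), ← setLIntegral_const]
    refine setLIntegral_mono_ae (hU.pow_const _).aemeasurable ?_
    filter_upwards [sphReg_ae_eq hV hU hUi] with y hy hys
    rw [← hy, ← ENNReal.rpow_inv_le_iff hβ0]
    exact (hs hys).le
  · rw [gt_iff_lt, ← ENNReal.lt_rpow_inv_iff hβ0] at hc
    obtain ⟨m, hm, hmc⟩ := exists_between hc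
    rw [ENNReal.lt_rpow_inv_iff hβ0] at hmc
    filter_upwards [eventually_laverage_geodBall_le hV hU hUi hn x hm, self_mem_nhdsWithin]
      with s hs hs0
    refine (laverage_rpow_le (roundVol_geodBall_pos x hs0) (measure_ne_top _ _) hU.aemeasurable
      hβ0 hβ1).trans_lt (lt_of_le_of_lt ?_ hmc)
    exact ENNReal.rpow_le_rpow hs hβ0.le

end Spherical

/-! ### Compactness -/

section Compactness

open Metric

/-- Weak sequential compactness of bounded sets in `L²`, tested against indicator functions. -/
theorem exists_subseq_tendsto_setIntegral {α : Type*} [MeasurableSpace α] {ν : Measure α}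
    [MeasurableSpace.CountablyGenerated α] [SigmaFinite ν] {w : ℕ → α → ℝ}
    (hw : ∀ j, MemLp (w j) 2 ν) {M : ℝ} (hM : ∀ j, eLpNorm (w j) 2 ν ≤ ENNReal.ofReal M) :
    ∃ φ : ℕ → ℕ, StrictMono φ ∧ ∀ s, MeasurableSet s → ν s ≠ ⊤ →
      ∃ l, Tendsto (fun j => ∫ x in s, w (φ j) x ∂ν) atTop (𝓝 l) := by
  have : Fact ((2 : ℝ≥0∞) ≠ ⊤) := ⟨ENNReal.ofNat_ne_top⟩
  let x : ℕ → Lp ℝ 2 ν := fun j => (hw j).toLp (w j)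
  let y : ℕ → WeakDual ℝ (Lp ℝ 2 ν) := fun j =>
    StrongDual.toWeakDual (InnerProductSpace.toDual ℝ (Lp ℝ 2 ν) (x j))
  have hy : ∀ j, y j ∈ WeakDual.toStrongDual ⁻¹' closedBall (0 : StrongDual ℝ (Lp ℝ 2 ν)) |M| := by
    intro j
    simp only [Set.mem_preimage, mem_closedBall, dist_zero_right]
    change ‖InnerProductSpace.toDual ℝ (Lp ℝ 2 ν) (x j)‖ ≤ |M|
    rw [LinearIsometryEquiv.norm_map, Lp.norm_toLp]
    refine ENNReal.toReal_le_of_le_ofReal (abs_nonneg _) ((hM j).trans ?_)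
    exact ENNReal.ofReal_le_ofReal (le_abs_self M)
  obtain ⟨l, -, φ, hφ, hlim⟩ := WeakDual.isSeqCompact_closedBall ℝ (Lp ℝ 2 ν) 0 |M| hy
  refine ⟨φ, hφ, fun s hs hνs => ⟨l (indicatorConstLp 2 hs hνs (1 : ℝ)), ?_⟩⟩
  have h1 := ((WeakDual.eval_continuous (𝕜 := ℝ) (E := Lp ℝ 2 ν)
    (indicatorConstLp 2 hs hνs (1 : ℝ))).tendsto l).comp hlim
  refine h1.congr fun j => ?_
  have h2 : (y (φ j)) (indicatorConstLp 2 hs hνs (1 : ℝ)) =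
      inner ℝ (indicatorConstLp 2 hs hνs (1 : ℝ)) (x (φ j)) := by
    rw [real_inner_comm]
    rfl
  simp only [Function.comp]
  rw [h2, L2.inner_indicatorConstLp_one]
  exact setIntegral_congr_ae hs ((hw (φ j)).coeFn_toLp.mono fun z hz _ => hz)

variable {E : Type*} [NormedAddCommGroup E] [InnerProductSpace ℝ E] [FiniteDimensional ℝ E]
  [MeasurableSpace E] [BorelSpace E]

theorem measurable_indicator_ball {V : E → ℝ≥0∞} (hV : Measurable V) (r : ℝ) :
    Measurable fun z : E × E => (ball z.1 r).indicator V z.2 := by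
  have hset : MeasurableSet {z : E × E | z.2 ∈ ball z.1 r} :=
    (isOpen_lt (by fun_prop : Continuous fun z : E × E => dist z.2 z.1)
      continuous_const).measurableSet
  exact (hV.comp measurable_snd).indicator hset

theorem measurable_ballMean {V : E → ℝ≥0∞} (hV : Measurable V) (r : ℝ) :
    Measurable fun x => ballMean V x r := by
  simp only [ballMean_eq_div, Measure.addHaar_ball_center, ← lintegral_indicator measurableSet_ball]
  exact (measurable_indicator_ball hV r).lintegral_prod_right'.div_const _

/-- Averaging over the balls of a fixed radius is a symmetric operator. -/
theorem lintegral_mul_ballMean {χ V : E → ℝ≥0∞} (hχ : Measurable χ) (hV : Measurable V) (r : ℝ) :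
    ∫⁻ x, χ x * ballMean V x r = ∫⁻ y, ballMean χ y r * V y := by
  have h1 : ∀ A : E → ℝ≥0∞, ∀ x, ballMean A x r =
      (volume (ball (0 : E) r))⁻¹ * ∫⁻ y, (ball x r).indicator A y := fun A x => by
    rw [ballMean_eq_div, Measure.addHaar_ball_center, lintegral_indicator measurableSet_ball,
      div_eq_mul_inv, mul_comm]
  simp only [h1]
  have hm := measurable_indicator_ball hV r
  have hm' := measurable_indicator_ball hχ r
  calc ∫⁻ x, χ x * ((volume (ball (0 : E) r))⁻¹ * ∫⁻ y, (ball x r).indicator V y)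
      = ∫⁻ x, (volume (ball (0 : E) r))⁻¹ * ∫⁻ y, χ x * (ball x r).indicator V y := by
        refine lintegral_congr fun x => ?_
        rw [lintegral_const_mul _ (hV.indicator measurableSet_ball)]
        ring
    _ = (volume (ball (0 : E) r))⁻¹ * ∫⁻ x, ∫⁻ y, χ x * (ball x r).indicator V y :=
        lintegral_const_mul _ ((hχ.comp measurable_fst).mul hm).lintegral_prod_right'
    _ = (volume (ball (0 : E) r))⁻¹ * ∫⁻ y, ∫⁻ x, χ x * (ball x r).indicator V y := by
        rw [lintegral_lintegral_swap]
        exact ((hχ.comp measurable_fst).mul hm).aemeasurable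
    _ = (volume (ball (0 : E) r))⁻¹ * ∫⁻ y, (∫⁻ x, (ball y r).indicator χ x) * V y := by
        congr 1
        refine lintegral_congr fun y => ?_
        rw [← lintegral_mul_const _ (hχ.indicator measurableSet_ball)]
        refine lintegral_congr fun x => ?_
        by_cases h : dist x y < r
        · have h' : dist y x < r := by rwa [dist_comm]
          simp [h, h']
        · have h' : ¬ dist y x < r := by rwa [dist_comm]
          simp [h, h']
    _ = _ := by
        have hm'' : Measurable fun y => (∫⁻ x, (ball y r).indicator χ x) * V y :=
          (Measurable.lintegral_prod_right' (ν := volume) hm').mul hV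
        rw [← lintegral_const_mul _ hm'']
        exact lintegral_congr fun y => by ring

/-- A function which dominates its ball means is `L¹` close to them, locally and at a rate that only
depends on its `L¹` norm. The difference has a sign, so its norm is computed by testing with a
Lipschitz cutoff function, which changes little under averaging. -/
theorem setLIntegral_sub_ballMean_le {V : E → ℝ≥0∞} (hV : Measurable V) {K T : Set E}
    (hT : thickening (1 / 2) K ⊆ T) (hTm : MeasurableSet T) (hKm : MeasurableSet K) {r : ℝ}
    (hr : 0 < r) (h : ∀ x ∈ T, ballMean V x r ≤ V x) (hfin : ∫⁻ x in T, V x ≠ ⊤) :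
    ∫⁻ x in K, (V x - ballMean V x r) ≤ ENNReal.ofReal (2 * r) * ∫⁻ x in T, V x := by
  rcases K.eq_empty_or_nonempty with rfl | hK
  · simp
  set χ : E → ℝ≥0∞ := fun x => ENNReal.ofReal (1 - 2 * infDist x K) with hχdef
  have hχ : Measurable χ := by fun_prop
  have hχ1 : ∀ x, χ x ≤ 1 := fun x => by
    rw [ENNReal.ofReal_le_one]
    linarith [infDist_nonneg (x := x) (s := K)]
  have hχK : ∀ x ∈ K, χ x = 1 := fun x hx => by simp [hχdef, infDist_zero_of_mem hx]
  have hχT : ∀ x, x ∉ T → χ x = 0 := fun x hx => by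
    have : ¬ infDist x K < 1 / 2 := fun h => hx (hT ((mem_thickening_iff_infDist_lt hK).2 h))
    rw [hχdef, ENNReal.ofReal_eq_zero]
    linarith
  have hχlip : ∀ y, χ y ≤ ballMean χ y r + ENNReal.ofReal (2 * r) := fun y => by
    have h1 : ∀ x ∈ ball y r, χ y - ENNReal.ofReal (2 * r) ≤ χ x := fun x hx => by
      rw [tsub_le_iff_right, hχdef]
      refine le_trans (ENNReal.ofReal_le_ofReal ?_) ENNReal.ofReal_add_le
      have := infDist_le_infDist_add_dist (s := K) (x := x) (y := y)
      linarith [mem_ball.1 hx]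
    rw [← tsub_le_iff_right, ballMean_eq_div, ENNReal.le_div_iff_mul_le
      (Or.inl (volume_ball_pos hr)) (Or.inl volume_ball_ne_top), ← setLIntegral_const]
    exact setLIntegral_mono hχ h1
  have hB := measurable_ballMean hV r
  have hB' := measurable_ballMean hχ r
  have hsplit : ∫⁻ x, χ x * V x = (∫⁻ x, χ x * ballMean V x r) +
      ∫⁻ x, χ x * (V x - ballMean V x r) := by
    rw [← lintegral_add_left (hf := (by fun_prop : Measurable fun x => χ x * ballMean V x r))]
    refine lintegral_congr fun x => ?_
    by_cases hx : x ∈ T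
    · rw [← mul_add, add_tsub_cancel_of_le (h x hx)]
    · simp [hχT x hx]
  have hle : ∫⁻ x, χ x * V x ≤ (∫⁻ x, χ x * ballMean V x r) +
      ENNReal.ofReal (2 * r) * ∫⁻ x in T, V x := by
    rw [lintegral_mul_ballMean hχ hV, ← lintegral_indicator hTm,
      ← lintegral_const_mul _ (hV.indicator hTm),
      ← lintegral_add_left (hf := (by fun_prop : Measurable fun y => ballMean χ y r * V y))]
    refine lintegral_mono fun y => ?_
    by_cases hy : y ∈ T
    · rw [Set.indicator_of_mem hy, ← add_mul]
      gcongr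
      exact hχlip y
    · simp [hχT y hy]
  have hfin' : ∫⁻ x, χ x * ballMean V x r ≠ ⊤ := by
    refine ne_top_of_le_ne_top hfin (le_trans le_self_add (hsplit.symm.trans_le ?_))
    rw [← lintegral_indicator hTm]
    refine lintegral_mono fun x => ?_
    by_cases hx : x ∈ T
    · rw [Set.indicator_of_mem hx]
      exact mul_le_of_le_one_left zero_le (hχ1 x)
    · simp [hχT x hx]
  rw [hsplit] at hle
  refine le_trans ?_ ((ENNReal.add_le_add_iff_left hfin').1 hle)
  rw [← lintegral_indicator hKm]
  refine lintegral_mono fun x => ?_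
  by_cases hx : x ∈ K
  · rw [Set.indicator_of_mem hx, hχK x hx, one_mul]
  · simp [hx]

variable {n : ℕ}

theorem thickening_sector_subset :
    thickening (1 / 2) (sector (Set.univ : Set (Sph n)) 1 2) ⊆ sector Set.univ (1 / 2) 3 := by
  intro x hx
  obtain ⟨y, hy, hxy⟩ := mem_thickening_iff.1 hx
  have h1 := hy.1
  have h2 := abs_lt.1 (lt_of_le_of_lt (abs_norm_sub_norm_le x y) (by rwa [← dist_eq_norm]))
  exact ⟨⟨by linarith [h1.1, h2.1], by linarith [h1.2, h2.2]⟩, Set.mem_univ _⟩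

theorem ball_subset_sector {x : EuclideanSpace ℝ (Fin (n + 1))}
    (hx : x ∈ sector (Set.univ : Set (Sph n)) (1 / 2) 3) {r : ℝ} (hr : r ≤ 1 / 4) :
    ball x r ⊆ sector Set.univ (1 / 4) 4 := by
  intro y hy
  have h1 := hx.1
  have h2 := abs_lt.1 (lt_of_le_of_lt (abs_norm_sub_norm_le y x)
    (by rw [← dist_eq_norm]; exact mem_ball.1 hy))
  exact ⟨⟨by linarith [h1.1, h2.1], by linarith [h1.2, h2.2]⟩, Set.mem_univ _⟩

theorem sector_subset_sector {a b a' b' : ℝ} (ha : a' ≤ a) (hb : b ≤ b') (S : Set (Sph n)) :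
    sector S a b ⊆ sector S a' b' := fun _ hx =>
  ⟨⟨ha.trans_lt hx.1.1, hx.1.2.trans_le hb⟩, hx.2⟩

theorem measurable_homExt {u : Sph n → ℝ} (hu : Measurable u) : Measurable (homExt u) :=
  (by fun_prop : Measurable fun x : EuclideanSpace ℝ (Fin (n + 1)) =>
    ‖x‖ ^ ((2 - (n : ℝ)) / 2)).mul (hu.comp measurable_radialProj)

theorem enorm_homExt (u : Sph n → ℝ) (x : EuclideanSpace ℝ (Fin (n + 1))) :
    ‖homExt u x‖ₑ = lhomExt (fun p => ‖u p‖ₑ) x := by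
  rw [homExt, lhomExt, enorm_mul, Real.enorm_eq_ofReal (by positivity)]

theorem homExt_sub (u v : Sph n → ℝ) (x : EuclideanSpace ℝ (Fin (n + 1))) :
    homExt (fun p => u p - v p) x = homExt u x - homExt v x := by
  simp only [homExt]
  ring

theorem homExt_nonneg {u : Sph n → ℝ} (hu : ∀ p, 0 ≤ u p) (x : EuclideanSpace ℝ (Fin (n + 1))) :
    0 ≤ homExt u x :=
  mul_nonneg (by positivity) (hu _)

/-- Square integrability passes from the sphere to shells. -/
theorem exists_setLIntegral_sq_le : ∃ C : ℝ≥0∞, C ≠ ⊤ ∧ ∀ u : Sph n → ℝ, Measurable u →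
    ∫⁻ x in sector Set.univ (1 / 4) 4, ‖homExt u x‖ₑ ^ (2 : ℝ) ≤
      C * ∫⁻ p, ‖u p‖ₑ ^ (2 : ℝ) ∂roundVol n := by
  refine ⟨∫⁻ r in Set.Ioo (1 / 4) 4, ENNReal.ofReal (r ^ ((2 - (n : ℝ)) / 2)) ^ (2 : ℝ) *
    ENNReal.ofReal (r ^ n), ?_, fun u hu => ?_⟩
  · have hc : ContinuousOn (fun r : ℝ => ENNReal.ofReal (r ^ ((2 - (n : ℝ)) / 2)) ^ (2 : ℝ) *
        ENNReal.ofReal (r ^ n)) (Set.Icc (1 / 4) 4) := by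
      have h1 : ContinuousOn (fun r : ℝ => r ^ ((2 - (n : ℝ)) / 2)) (Set.Icc (1 / 4) 4) :=
        continuousOn_id.rpow_const fun r hr => Or.inl (by linarith [hr.1] : (0 : ℝ) < r).ne'
      have h2 : ContinuousOn (fun r : ℝ => ENNReal.ofReal ((r ^ ((2 - (n : ℝ)) / 2)) ^ 2 * r ^ n))
          (Set.Icc (1 / 4) 4) :=
        ENNReal.continuous_ofReal.comp_continuousOn ((h1.pow 2).mul (by fun_prop))
      refine h2.congr fun r hr => ?_
      have hr0 : (0 : ℝ) < r := by linarith [hr.1]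
      beta_reduce
      rw [ENNReal.ofReal_mul (by positivity), ENNReal.ofReal_pow (p := r ^ ((2 - (n : ℝ)) / 2))
        (by positivity), ENNReal.rpow_ofNat]
    obtain ⟨m, hm, hmax⟩ := isCompact_Icc.exists_isMaxOn
      (Set.nonempty_Icc.2 (by norm_num : (1 / 4 : ℝ) ≤ 4)) hc
    refine ne_top_of_le_ne_top ?_ (setLIntegral_mono measurable_const fun r hr =>
      hmax (Set.Ioo_subset_Icc_self hr))
    rw [setLIntegral_const]
    exact ENNReal.mul_ne_top (by finiteness) measure_Ioo_lt_top.ne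
  · have h := setLIntegral_sector (n := n) MeasurableSet.univ (a := 1 / 4) (b := 4) (by norm_num)
      (h := fun r => ENNReal.ofReal (r ^ ((2 - (n : ℝ)) / 2)) ^ (2 : ℝ)) (by fun_prop)
      (g := fun p => ‖u p‖ₑ ^ (2 : ℝ)) (by fun_prop)
    rw [Measure.restrict_univ] at h
    rw [← h]
    refine le_of_eq (lintegral_congr fun x => ?_)
    rw [enorm_homExt, lhomExt, ENNReal.mul_rpow_of_nonneg _ _ (by norm_num)]

/-- A sequence bounded in `L²` of nonnegative functions on the sphere whose extensions dominate
their ball means is relatively compact in `L¹`. -/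
theorem exists_subseq_tendsto_eLpNorm_one {u : ℕ → Sph n → ℝ} (hu0 : ∀ j p, 0 ≤ u j p)
    (hum : ∀ j, Measurable (u j))
    (hsup : ∀ j x r, r ∈ Set.Ioo 0 ‖x‖ →
      ballMean (fun y => ENNReal.ofReal (homExt (u j) y)) x r ≤ ENNReal.ofReal (homExt (u j) x))
    {M : ℝ≥0∞} (hM : M ≠ ⊤) (hL2 : ∀ j, ∫⁻ p, ‖u j p‖ₑ ^ (2 : ℝ) ∂roundVol n ≤ M) :
    ∃ (φ : ℕ → ℕ) (v : Sph n → ℝ), StrictMono φ ∧ MemLp v 1 (roundVol n) ∧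
      Tendsto (fun k => eLpNorm (fun p => u (φ k) p - v p) 1 (roundVol n)) atTop (𝓝 0) := by
  set T' : Set (EuclideanSpace ℝ (Fin (n + 1))) := sector Set.univ (1 / 4) 4
  set T : Set (EuclideanSpace ℝ (Fin (n + 1))) := sector Set.univ (1 / 2) 3
  set K : Set (EuclideanSpace ℝ (Fin (n + 1))) := sector Set.univ 1 2
  have hT'm : MeasurableSet T' := measurableSet_sector MeasurableSet.univ _ _
  have hTm : MeasurableSet T := measurableSet_sector MeasurableSet.univ _ _
  have hKm : MeasurableSet K := measurableSet_sector MeasurableSet.univ _ _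
  have hKT : K ⊆ T := sector_subset_sector (by norm_num) (by norm_num) _
  have hTT' : T ⊆ T' := sector_subset_sector (by norm_num) (by norm_num) _
  have hw0 : ∀ j x, 0 ≤ homExt (u j) x := fun j => homExt_nonneg (hu0 j)
  have hwm : ∀ j, Measurable (homExt (u j)) := fun j => measurable_homExt (hum j)
  set V : ℕ → EuclideanSpace ℝ (Fin (n + 1)) → ℝ≥0∞ := fun j x => ENNReal.ofReal (homExt (u j) x)
    with hVdef
  have hVm : ∀ j, Measurable (V j) := fun j => (hwm j).ennreal_ofReal
  -- uniform `L¹` bounds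
  have hL1 : ∀ j, ∫⁻ p, ‖u j p‖ₑ ∂roundVol n ≤ roundVol n Set.univ + M := fun j => by
    calc ∫⁻ p, ‖u j p‖ₑ ∂roundVol n ≤ ∫⁻ p, (1 + ‖u j p‖ₑ ^ (2 : ℝ)) ∂roundVol n := by
          refine lintegral_mono fun p => ?_
          rcases le_total ‖u j p‖ₑ 1 with h | h
          · exact h.trans le_self_add
          · refine le_trans ?_ le_add_self
            simpa using ENNReal.rpow_le_rpow_of_exponent_le h (by norm_num : (1 : ℝ) ≤ 2)
      _ ≤ roundVol n Set.univ + M := by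
          rw [lintegral_add_left measurable_const, lintegral_const, one_mul]
          gcongr
          exact hL2 j
  set M₁ : ℝ≥0∞ := radialMass n (1 / 4) 4 * (roundVol n Set.univ + M)
  have hM₁ : M₁ ≠ ⊤ := ENNReal.mul_ne_top (radialMass_ne_top (by norm_num))
    (ENNReal.add_ne_top.2 ⟨measure_ne_top _ _, hM⟩)
  have hVL1 : ∀ j, ∫⁻ x in T', V j x ≤ M₁ := fun j => by
    have h := setLIntegral_sector_lhomExt (n := n) MeasurableSet.univ (a := 1 / 4) (b := 4)
      (by norm_num) (U := fun p => ‖u j p‖ₑ) (by fun_prop)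
    rw [Measure.restrict_univ] at h
    calc ∫⁻ x in T', V j x = ∫⁻ x in T', lhomExt (fun p => ‖u j p‖ₑ) x :=
          lintegral_congr fun x => by rw [← enorm_homExt, Real.enorm_eq_ofReal (hw0 j x)]
      _ = _ := h
      _ ≤ M₁ := mul_le_mul' le_rfl (hL1 j)
  -- a weakly convergent subsequence
  obtain ⟨C, hC, hCu⟩ := exists_setLIntegral_sq_le (n := n)
  have heL : ∀ j, eLpNorm (homExt (u j)) 2 (volume.restrict T') ≤
      ENNReal.ofReal ((C * M) ^ (1 / 2 : ℝ)).toReal := fun j => by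
    rw [ENNReal.ofReal_toReal (by finiteness),
      eLpNorm_eq_lintegral_rpow_enorm_toReal two_ne_zero ENNReal.ofNat_ne_top]
    simp only [ENNReal.toReal_ofNat]
    refine ENNReal.rpow_le_rpow ((hCu _ (hum j)).trans ?_) (by norm_num)
    gcongr
    exact hL2 j
  obtain ⟨φ, hφ, hlim⟩ := exists_subseq_tendsto_setIntegral
    (fun j => ⟨(hwm j).aestronglyMeasurable, (heL j).trans_lt ENNReal.ofReal_lt_top⟩) heL
  -- the ball means of the subsequence converge pointwise
  have hmeanlim : ∀ r ∈ Set.Ioc (0 : ℝ) (1 / 4), ∀ x ∈ K,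
      ∃ l, Tendsto (fun j => (ballMean (V (φ j)) x r).toReal) atTop (𝓝 l) := by
    intro r hr x hx
    have hsub : ball x r ⊆ T' := ball_subset_sector (hKT hx) hr.2
    obtain ⟨l, hl⟩ := hlim (ball x r) measurableSet_ball
      (ne_top_of_le_ne_top volume_ball_ne_top (Measure.restrict_apply_le _ _))
    refine ⟨l / (volume (ball x r)).toReal, (hl.div_const _).congr fun j => ?_⟩
    rw [ballMean_eq_div, ENNReal.toReal_div, Measure.restrict_restrict measurableSet_ball,
      Set.inter_eq_left.2 hsub, integral_eq_lintegral_of_nonneg_ae (ae_of_all _ fun _ => hw0 _ _)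
        (hwm _).aestronglyMeasurable]
  have hbd : ∀ j r, r ∈ Set.Ioc (0 : ℝ) (1 / 4) → ∀ x ∈ K,
      ballMean (V j) x r ≤ M₁ / volume (ball (0 : EuclideanSpace ℝ (Fin (n + 1))) r) := by
    intro j r hr x hx
    rw [ballMean_eq_div, Measure.addHaar_ball_center]
    exact ENNReal.div_le_div_right ((lintegral_mono_set
      (ball_subset_sector (hKT hx) hr.2)).trans (hVL1 j)) _
  have hbdtop : ∀ r, r ∈ Set.Ioc (0 : ℝ) (1 / 4) →
      M₁ / volume (ball (0 : EuclideanSpace ℝ (Fin (n + 1))) r) ≠ ⊤ := fun r hr =>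
    ENNReal.div_ne_top hM₁ (volume_ball_pos hr.1)
  have hKvol : volume K ≠ ⊤ := by
    refine ne_top_of_le_ne_top (volume_ball_ne_top (x := 0) (r := 2)) (measure_mono fun x hx => ?_)
    simpa using hx.1.2
  have hmeanCauchy : ∀ r ∈ Set.Ioc (0 : ℝ) (1 / 4), Tendsto (fun q : ℕ × ℕ => ∫⁻ x in K,
      ‖(ballMean (V (φ q.1)) x r).toReal - (ballMean (V (φ q.2)) x r).toReal‖ₑ)
      atTop (𝓝 0) := by
    intro r hr
    have hz : ∫⁻ x in K, (0 : ℝ≥0∞) = 0 := lintegral_zero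
    rw [← hz]
    refine tendsto_lintegral_filter_of_dominated_convergence
      (fun _ => 2 * (M₁ / volume (ball (0 : EuclideanSpace ℝ (Fin (n + 1))) r))) ?_ ?_ ?_ ?_
    · refine Eventually.of_forall fun q => ?_
      exact ((measurable_ballMean (hVm _) r).ennreal_toReal.sub
        (measurable_ballMean (hVm _) r).ennreal_toReal).enorm
    · refine Eventually.of_forall fun q => ?_
      filter_upwards [ae_restrict_mem hKm] with x hx
      refine (enorm_sub_le).trans ?_
      rw [two_mul]
      gcongr
      all_goals
        rw [Real.enorm_eq_ofReal ENNReal.toReal_nonneg]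
        exact ENNReal.ofReal_toReal_le.trans (hbd _ r hr x hx)
    · rw [setLIntegral_const]
      exact ENNReal.mul_ne_top (ENNReal.mul_ne_top (by finiteness) (hbdtop r hr)) hKvol
    · filter_upwards [ae_restrict_mem hKm] with x hx
      obtain ⟨l, hl⟩ := hmeanlim r hr x hx
      have h1 : Tendsto (fun q : ℕ × ℕ => (ballMean (V (φ q.1)) x r).toReal -
          (ballMean (V (φ q.2)) x r).toReal) atTop (𝓝 (l - l)) := by
        rw [← prod_atTop_atTop_eq]
        exact (hl.comp tendsto_fst).sub (hl.comp tendsto_snd)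
      simpa using h1.enorm
  -- the functions themselves are close to their ball means
  have hclose : ∀ j r, r ∈ Set.Ioc (0 : ℝ) (1 / 4) →
      ∫⁻ x in K, ‖homExt (u j) x - (ballMean (V j) x r).toReal‖ₑ ≤ ENNReal.ofReal (2 * r) * M₁ := by
    intro j r hr
    have hdom : ∀ x ∈ T, ballMean (V j) x r ≤ V j x := fun x hx =>
      hsup j x r ⟨hr.1, by linarith [hx.1.1, hr.2]⟩
    have hTL1 : ∫⁻ x in T, V j x ≤ M₁ := (lintegral_mono_set hTT').trans (hVL1 j)
    have h := setLIntegral_sub_ballMean_le (hVm j) thickening_sector_subset hTm hKm hr.1 hdom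
      (ne_top_of_le_ne_top hM₁ hTL1)
    refine (le_of_eq (setLIntegral_congr_fun hKm fun x hx => ?_)).trans (h.trans (by gcongr))
    have hle := hdom x (hKT hx)
    have htop : ballMean (V j) x r ≠ ⊤ := ne_top_of_le_ne_top ENNReal.ofReal_ne_top hle
    rw [Real.enorm_eq_ofReal, ENNReal.ofReal_sub _ ENNReal.toReal_nonneg,
      ENNReal.ofReal_toReal htop]
    rw [sub_nonneg]
    exact ENNReal.toReal_le_of_le_ofReal (hw0 j x) hle
  -- hence the subsequence is Cauchy in `L¹`
  have hrad0 : radialMass n 1 2 ≠ 0 := radialMass_pos zero_le_one one_lt_two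
  have hradtop : radialMass n 1 2 ≠ ⊤ := radialMass_ne_top zero_le_one
  have hKu : ∀ i j, radialMass n 1 2 * eLpNorm (u i - u j) 1 (roundVol n) =
      ∫⁻ x in K, ‖homExt (u i) x - homExt (u j) x‖ₑ := fun i j => by
    have h := setLIntegral_sector_lhomExt (n := n) MeasurableSet.univ (a := 1) (b := 2)
      (by norm_num) (U := fun p => ‖u i p - u j p‖ₑ) (by fun_prop)
    rw [Measure.restrict_univ] at h
    rw [eLpNorm_one_eq_lintegral_enorm]
    refine h.symm.trans (lintegral_congr fun x => ?_)
    rw [← enorm_homExt, homExt_sub]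
  have hcau : Tendsto (fun q : ℕ × ℕ => radialMass n 1 2 *
      eLpNorm (u (φ q.1) - u (φ q.2)) 1 (roundVol n)) atTop (𝓝 0) := by
    rw [ENNReal.tendsto_nhds_zero]
    intro ε hε
    have hsmall : Tendsto (fun r : ℝ => ENNReal.ofReal (2 * r) * M₁ + ENNReal.ofReal (2 * r) * M₁)
        (𝓝[>] 0) (𝓝 0) := by
      have h1 : Tendsto (fun r : ℝ => ENNReal.ofReal (2 * r)) (𝓝[>] 0) (𝓝 0) := by
        have : Tendsto (fun r : ℝ => ENNReal.ofReal (2 * r)) (𝓝 0) (𝓝 (ENNReal.ofReal (2 * 0))) :=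
          (ENNReal.continuous_ofReal.comp (continuous_const.mul continuous_id)).tendsto 0
        rw [mul_zero, ENNReal.ofReal_zero] at this
        exact this.mono_left nhdsWithin_le_nhds
      have h2 := ENNReal.Tendsto.mul_const (b := M₁) h1 (Or.inr hM₁)
      rw [zero_mul] at h2
      simpa using h2.add h2
    obtain ⟨r, hrε, hr⟩ := ((ENNReal.tendsto_nhds_zero.1 hsmall (ε / 2)
      (ENNReal.half_pos hε.ne')).and (Ioc_mem_nhdsGT (show (0 : ℝ) < 1 / 4 by norm_num))).exists
    filter_upwards [ENNReal.tendsto_nhds_zero.1 (hmeanCauchy r hr) (ε / 2)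
      (ENNReal.half_pos hε.ne')] with q hq
    rw [hKu]
    have hmb : ∀ j, Measurable fun x => (ballMean (V j) x r).toReal := fun j =>
      (measurable_ballMean (hVm j) r).ennreal_toReal
    have htri : ∀ a b c d : ℝ, ‖a - b‖ₑ ≤ ‖a - c‖ₑ + ‖b - d‖ₑ + ‖c - d‖ₑ := fun a b c d => by
      have h1 : a - b = (a - c) + (-(b - d) + (c - d)) := by ring
      rw [h1, add_assoc]
      refine (enorm_add_le _ _).trans ?_
      gcongr
      refine (enorm_add_le _ _).trans ?_
      rw [enorm_neg]
    calc ∫⁻ x in K, ‖homExt (u (φ q.1)) x - homExt (u (φ q.2)) x‖ₑ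
        ≤ ∫⁻ x in K, (‖homExt (u (φ q.1)) x - (ballMean (V (φ q.1)) x r).toReal‖ₑ +
            ‖homExt (u (φ q.2)) x - (ballMean (V (φ q.2)) x r).toReal‖ₑ +
            ‖(ballMean (V (φ q.1)) x r).toReal - (ballMean (V (φ q.2)) x r).toReal‖ₑ) :=
          lintegral_mono fun x => htri _ _ _ _
      _ = (∫⁻ x in K, ‖homExt (u (φ q.1)) x - (ballMean (V (φ q.1)) x r).toReal‖ₑ) +
            (∫⁻ x in K, ‖homExt (u (φ q.2)) x - (ballMean (V (φ q.2)) x r).toReal‖ₑ) +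
            ∫⁻ x in K, ‖(ballMean (V (φ q.1)) x r).toReal -
              (ballMean (V (φ q.2)) x r).toReal‖ₑ := by
          have hm1 : Measurable fun x => ‖(ballMean (V (φ q.1)) x r).toReal -
              (ballMean (V (φ q.2)) x r).toReal‖ₑ := ((hmb _).sub (hmb _)).enorm
          have hm2 : Measurable fun x => ‖homExt (u (φ q.2)) x -
              (ballMean (V (φ q.2)) x r).toReal‖ₑ := ((hwm _).sub (hmb _)).enorm
          rw [lintegral_add_right _ hm1, lintegral_add_right _ hm2]
      _ ≤ ENNReal.ofReal (2 * r) * M₁ + ENNReal.ofReal (2 * r) * M₁ + ε / 2 := by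
          gcongr
          · exact hclose _ r hr
          · exact hclose _ r hr
      _ ≤ ε / 2 + ε / 2 := by gcongr
      _ = ε := ENNReal.add_halves ε
  have hcau' : Tendsto (fun q : ℕ × ℕ => eLpNorm (u (φ q.1) - u (φ q.2)) 1 (roundVol n))
      atTop (𝓝 0) := by
    have h := ENNReal.Tendsto.const_mul (a := (radialMass n 1 2)⁻¹) hcau
      (Or.inr (ENNReal.inv_ne_top.2 hrad0))
    rw [mul_zero] at h
    refine h.congr fun q => ?_
    rw [← mul_assoc, ENNReal.inv_mul_cancel hrad0 hradtop, one_mul]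
  have hmem : ∀ j, MemLp (u j) 1 (roundVol n) := fun j => by
    refine ⟨(hum j).aestronglyMeasurable, ?_⟩
    rw [eLpNorm_one_eq_lintegral_enorm]
    exact (hL1 j).trans_lt (ENNReal.add_lt_top.2 ⟨measure_lt_top _ _, hM.lt_top⟩)
  have hseq : CauchySeq fun k => (hmem (φ k)).toLp (u (φ k)) := by
    rw [Lp.cauchySeq_Lp_iff_cauchySeq_eLpNorm]
    refine hcau'.congr fun q => eLpNorm_congr_ae ?_
    exact ((hmem (φ q.1)).coeFn_toLp.sub (hmem (φ q.2)).coeFn_toLp).symm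
  obtain ⟨v, hv⟩ := cauchySeq_tendsto_of_complete hseq
  refine ⟨φ, v, hφ, Lp.memLp v, ?_⟩
  rw [Lp.tendsto_Lp_iff_tendsto_eLpNorm'] at hv
  refine hv.congr fun k => eLpNorm_congr_ae ?_
  filter_upwards [(hmem (φ k)).coeFn_toLp] with p hp
  rw [Pi.sub_apply, hp]

end Compactness

/-! ### Convergence in the critical Lebesgue space -/

section Vitali

/-- Vitali's theorem for a sequence that converges in `L¹`: the limit lies in `L^q` by Fatou's
lemma. -/
theorem tendsto_eLpNorm_of_tendsto_eLpNorm_one {α : Type*} [MeasurableSpace α] {μ : Measure α}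
    [IsFiniteMeasure μ] {q : ℝ≥0∞} (hq1 : 1 ≤ q) (hq : q ≠ ⊤) {u : ℕ → α → ℝ} {v : α → ℝ}
    (hu : ∀ j, AEStronglyMeasurable (u j) μ) (hv : AEStronglyMeasurable v μ) {M : ℝ≥0∞}
    (hM : M ≠ ⊤) (hbd : ∀ j, eLpNorm (u j) q μ ≤ M) (hUI : UnifIntegrable u q μ)
    (h1 : Tendsto (fun j => eLpNorm (u j - v) 1 μ) atTop (𝓝 0)) :
    MemLp v q μ ∧ Tendsto (fun j => eLpNorm (u j - v) q μ) atTop (𝓝 0) := by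
  have hmeas := tendstoInMeasure_of_tendsto_eLpNorm one_ne_zero hu hv h1
  have hvq : MemLp v q μ := by
    obtain ⟨ns, -, hns⟩ := hmeas.exists_seq_tendsto_ae
    refine ⟨hv, lt_of_le_of_lt (Lp.eLpNorm_lim_le_liminf_eLpNorm (fun j => hu (ns j)) v hns)
      (lt_of_le_of_lt ?_ hM.lt_top)⟩
    exact liminf_le_of_frequently_le' (Frequently.of_forall fun j => hbd (ns j))
  exact ⟨hvq, tendsto_Lp_finite_of_tendstoInMeasure hq1 hq hu hvq hUI hmeas⟩

end Vitali

section ConformalFactor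

variable {n : ℕ}

theorem conformalFactor_pos (f : Sph n → ℝ) (x : Sph n) : 0 < conformalFactor f x := Real.exp_pos _

theorem measurable_conformalFactor {f : Sph n → ℝ} (hf : Measurable f) :
    Measurable (conformalFactor f) := by
  unfold conformalFactor
  fun_prop

/-- The critical Lebesgue exponent `2n/(n-2)`. -/
noncomputable def criticalExponent (n : ℕ) : ℝ := 2 * n / ((n : ℝ) - 2)

theorem two_lt_criticalExponent (hn : 3 ≤ n) : 2 < criticalExponent n := by
  have h : (3 : ℝ) ≤ n := by exact_mod_cast hn
  rw [criticalExponent, lt_div_iff₀ (by linarith)]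
  linarith

/-- The volume of the conformal metric is the integral of the critical power of the conformal
factor. -/
theorem setLIntegral_conformalFactor_rpow (hn : 3 ≤ n) (f : Sph n → ℝ) {U : Set (Sph n)}
    (hU : MeasurableSet U) :
    ∫⁻ x in U, ‖conformalFactor f x‖ₑ ^ criticalExponent n ∂roundVol n = conformalVol f U := by
  have h : (3 : ℝ) ≤ n := by exact_mod_cast hn
  have h2 : (n : ℝ) - 2 ≠ 0 := by linarith
  rw [conformalVol, withDensity_apply _ hU]
  refine lintegral_congr fun x => ?_
  rw [Real.enorm_eq_ofReal (conformalFactor_pos f x).le,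
    ENNReal.ofReal_rpow_of_pos (conformalFactor_pos f x), conformalFactor, ← Real.exp_mul,
    criticalExponent]
  congr 2
  field_simp

theorem eLpNorm_conformalFactor_indicator (hn : 3 ≤ n) (f : Sph n → ℝ) {U : Set (Sph n)}
    (hU : MeasurableSet U) :
    eLpNorm (U.indicator (conformalFactor f)) (ENNReal.ofReal (criticalExponent n)) (roundVol n) =
      conformalVol f U ^ (1 / criticalExponent n) := by
  have hq := two_lt_criticalExponent hn
  rw [eLpNorm_indicator_eq_eLpNorm_restrict hU,
    eLpNorm_eq_lintegral_rpow_enorm_toReal (by simpa using by linarith) ENNReal.ofReal_ne_top,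
    ENNReal.toReal_ofReal (by linarith), setLIntegral_conformalFactor_rpow hn f hU]

theorem eLpNorm_conformalFactor (hn : 3 ≤ n) (f : Sph n → ℝ) :
    eLpNorm (conformalFactor f) (ENNReal.ofReal (criticalExponent n)) (roundVol n) =
      conformalVol f Set.univ ^ (1 / criticalExponent n) := by
  simpa using eLpNorm_conformalFactor_indicator hn f MeasurableSet.univ

theorem lintegral_conformalFactor_sq_le (hn : 3 ≤ n) (f : Sph n → ℝ) :
    ∫⁻ x, ‖conformalFactor f x‖ₑ ^ (2 : ℝ) ∂roundVol n ≤
      roundVol n Set.univ + conformalVol f Set.univ := by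
  have hq := two_lt_criticalExponent hn
  rw [← setLIntegral_conformalFactor_rpow hn f MeasurableSet.univ, Measure.restrict_univ]
  calc ∫⁻ x, ‖conformalFactor f x‖ₑ ^ (2 : ℝ) ∂roundVol n
      ≤ ∫⁻ x, (1 + ‖conformalFactor f x‖ₑ ^ criticalExponent n) ∂roundVol n := by
        refine lintegral_mono fun x => ?_
        rcases le_total ‖conformalFactor f x‖ₑ 1 with h | h
        · exact (ENNReal.rpow_le_one h (by norm_num)).trans le_self_add
        · exact (ENNReal.rpow_le_rpow_of_exponent_le h hq.le).trans le_add_self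
    _ = _ := by rw [lintegral_add_left measurable_const, lintegral_const, one_mul]

theorem unifIntegrable_conformalFactor (hn : 3 ≤ n) {Λ α : ℝ} (hα : 0 < α) {f : ℕ → Sph n → ℝ}
    (hUI : ∀ j (U : Set (Sph n)), MeasurableSet U →
      conformalVol (f j) U ≤ ENNReal.ofReal Λ * roundVol n U ^ α) :
    UnifIntegrable (fun j => conformalFactor (f j)) (ENNReal.ofReal (criticalExponent n))
      (roundVol n) := by
  have hq : 0 < 1 / criticalExponent n :=
    one_div_pos.2 (two_pos.trans (two_lt_criticalExponent hn))
  have hlim : Tendsto (fun r : ℝ => (ENNReal.ofReal Λ * ENNReal.ofReal r ^ α) ^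
      (1 / criticalExponent n)) (𝓝 0) (𝓝 0) := by
    have hc : Continuous fun r : ℝ => (ENNReal.ofReal Λ * ENNReal.ofReal r ^ α) ^
        (1 / criticalExponent n) :=
      ENNReal.continuous_rpow_const.comp ((ENNReal.continuous_const_mul ENNReal.ofReal_ne_top).comp
        (ENNReal.continuous_rpow_const.comp ENNReal.continuous_ofReal))
    have := hc.tendsto 0
    rwa [ENNReal.ofReal_zero, ENNReal.zero_rpow_of_pos hα, mul_zero,
      ENNReal.zero_rpow_of_pos hq] at this
  intro ε hε
  obtain ⟨δ, hδε, hδ⟩ := ((ENNReal.tendsto_nhds_zero.1 (hlim.mono_left nhdsWithin_le_nhds) _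
    (ENNReal.ofReal_pos.2 hε)).and (self_mem_nhdsWithin (a := (0 : ℝ)) (s := Set.Ioi 0))).exists
  refine ⟨δ, hδ, fun j s hs hsδ => ?_⟩
  rw [eLpNorm_conformalFactor_indicator hn _ hs]
  refine le_trans (ENNReal.rpow_le_rpow ((hUI j s hs).trans ?_) hq.le) hδε
  gcongr

/-- Under the volume bounds, `L¹` convergence of conformal factors improves to convergence in the
critical Lebesgue space. -/
theorem tendsto_conformalFactor_critical (hn : 3 ≤ n) {V Λ α : ℝ} (hα : 0 < α)
    {f : ℕ → Sph n → ℝ} (hf : ∀ j, Measurable (f j))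
    (hVol : ∀ j, conformalVol (f j) Set.univ ≤ ENNReal.ofReal V)
    (hUI : ∀ j (U : Set (Sph n)), MeasurableSet U →
      conformalVol (f j) U ≤ ENNReal.ofReal Λ * roundVol n U ^ α)
    {v : Sph n → ℝ} (hv : MemLp v 1 (roundVol n))
    (h1 : Tendsto (fun j => eLpNorm (fun x => conformalFactor (f j) x - v x) 1 (roundVol n))
      atTop (𝓝 0)) :
    MemLp v (ENNReal.ofReal (criticalExponent n)) (roundVol n) ∧
      Tendsto (fun j => eLpNorm (fun x => conformalFactor (f j) x - v x)
        (ENNReal.ofReal (criticalExponent n)) (roundVol n)) atTop (𝓝 0) := by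
  have hq := two_lt_criticalExponent hn
  have hq0 : 0 ≤ 1 / criticalExponent n := by positivity
  refine tendsto_eLpNorm_of_tendsto_eLpNorm_one (by simpa using by linarith) ENNReal.ofReal_ne_top
    (fun j => (measurable_conformalFactor (hf j)).aestronglyMeasurable) hv.1
    (M := ENNReal.ofReal V ^ (1 / criticalExponent n))
    (ENNReal.rpow_ne_top_of_nonneg hq0 ENNReal.ofReal_ne_top) (fun j => ?_)
    (unifIntegrable_conformalFactor hn hα hUI) h1
  rw [eLpNorm_conformalFactor hn]
  exact ENNReal.rpow_le_rpow (hVol j) hq0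

theorem tendsto_eLpNorm_of_exponent_le {α : Type*} [MeasurableSpace α] {μ : Measure α}
    [IsFiniteMeasure μ] {p q : ℝ≥0∞} (hp : p ≠ 0) (hpq : p ≤ q) {u : ℕ → α → ℝ}
    (hu : ∀ j, AEStronglyMeasurable (u j) μ)
    (h : Tendsto (fun j => eLpNorm (u j) q μ) atTop (𝓝 0)) :
    Tendsto (fun j => eLpNorm (u j) p μ) atTop (𝓝 0) := by
  rcases eq_or_ne p ⊤ with rfl | hptop
  · rwa [top_le_iff.1 hpq] at h
  have hexp : 0 ≤ 1 / p.toReal - 1 / q.toReal := by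
    rw [sub_nonneg]
    rcases eq_or_ne q ⊤ with rfl | hqtop
    · simp
    · exact one_div_le_one_div_of_le (ENNReal.toReal_pos hp hptop)
        (ENNReal.toReal_mono hqtop hpq)
  have hlim := ENNReal.Tendsto.mul_const (b := μ Set.univ ^ (1 / p.toReal - 1 / q.toReal)) h
    (Or.inr (ENNReal.rpow_ne_top_of_nonneg hexp (measure_ne_top _ _)))
  rw [zero_mul] at hlim
  exact tendsto_of_tendsto_of_tendsto_of_le_of_le tendsto_const_nhds hlim (fun _ => zero_le)
    fun j => eLpNorm_le_eLpNorm_mul_rpow_measure_univ hpq (hu j)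

/-- The lower volume bound prevents the limit from vanishing. -/
theorem not_ae_eq_zero_of_tendsto (hn : 3 ≤ n) {V : ℝ} (hV : 0 < V) {f : ℕ → Sph n → ℝ}
    (hVol : ∀ j, ENNReal.ofReal V⁻¹ ≤ conformalVol (f j) Set.univ)
    {v : Sph n → ℝ}
    (hlim : Tendsto (fun j => eLpNorm (fun x => conformalFactor (f j) x - v x)
        (ENNReal.ofReal (criticalExponent n)) (roundVol n)) atTop (𝓝 0)) :
    ¬ v =ᵐ[roundVol n] 0 := by
  intro hv0
  have hq := two_lt_criticalExponent hn
  have hq0 : 0 ≤ 1 / criticalExponent n := by positivity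
  have h1 : ∀ j, eLpNorm (fun x => conformalFactor (f j) x - v x)
      (ENNReal.ofReal (criticalExponent n)) (roundVol n) =
        conformalVol (f j) Set.univ ^ (1 / criticalExponent n) := fun j => by
    rw [← eLpNorm_conformalFactor hn]
    refine eLpNorm_congr_ae ?_
    filter_upwards [hv0] with x hx
    simp [hx]
  have h2 : ENNReal.ofReal V⁻¹ ^ (1 / criticalExponent n) ≤ 0 :=
    ge_of_tendsto' hlim fun j => (h1 j).symm ▸ ENNReal.rpow_le_rpow (hVol j) hq0
  have h3 : 0 < ENNReal.ofReal V⁻¹ ^ (1 / criticalExponent n) :=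
    ENNReal.rpow_pos (ENNReal.ofReal_pos.2 (inv_pos.2 hV)) ENNReal.ofReal_ne_top
  exact h3.not_ge h2

theorem isSuperMean_conformalFactor (hn : 3 ≤ n) {f : Sph n → ℝ}
    (hf : ContMDiff (𝓡 n) 𝓘(ℝ, ℝ) ∞ f) (hSc : ∀ x, 0 ≤ scalarCurvature f x) :
    IsSuperMean (lhomExt fun p => ENNReal.ofReal (conformalFactor f p)) := by
  have h := isSuperMean_ofReal (w := homExt (conformalFactor f))
    (homExt_nonneg fun p => (conformalFactor_pos f p).le)
    (fun x hx => (contDiffAt_homExt_conformalFactor hf hx).of_le (by norm_cast))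
    fun x hx => laplacian_homExt_nonpos hn hf hSc hx
  simpa only [ofReal_homExt] using h

/-- Superharmonicity of the homogeneous extension passes to `L¹` limits. -/
theorem isSuperMean_of_tendsto {u : ℕ → Sph n → ℝ} (hum : ∀ j, Measurable (u j))
    (hu : ∀ j, IsSuperMean (lhomExt fun p => ENNReal.ofReal (u j p))) {v : Sph n → ℝ}
    (hv : Measurable v)
    (h1 : Tendsto (fun j => eLpNorm (fun x => u j x - v x) 1 (roundVol n)) atTop (𝓝 0)) :
    IsSuperMean (lhomExt fun p => ENNReal.ofReal (v p)) := by
  have hle : ∀ a b : ℝ, ENNReal.ofReal a ≤ ENNReal.ofReal b + ‖b - a‖ₑ := fun a b => by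
    rw [← ofReal_norm]
    refine le_trans (ENNReal.ofReal_le_ofReal ?_) ENNReal.ofReal_add_le
    rw [Real.norm_eq_abs]
    linarith [neg_abs_le (b - a)]
  have hle' : ∀ a b : ℝ, ENNReal.ofReal b ≤ ENNReal.ofReal a + ‖b - a‖ₑ := fun a b => by
    rw [enorm_sub_rev]
    exact hle b a
  refine IsSuperMean.of_tendsto hu (e := fun j => lhomExt fun p => ‖u j p - v p‖ₑ)
    (fun j => measurable_lhomExt ((hum j).sub hv).enorm) (fun j x => ?_) (fun j x => ?_)
    fun R => ?_
  · simp only [lhomExt]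
    rw [← mul_add]
    gcongr
    exact hle _ _
  · simp only [lhomExt]
    rw [← mul_add]
    gcongr
    exact hle' _ _
  · have hlim := ENNReal.Tendsto.const_mul (a := radialMass n 0 R) h1
      (Or.inr (radialMass_ne_top le_rfl))
    rw [mul_zero] at hlim
    refine tendsto_of_tendsto_of_tendsto_of_le_of_le tendsto_const_nhds hlim (fun _ => zero_le)
      fun j => ?_
    rw [eLpNorm_one_eq_lintegral_enorm]
    exact setLIntegral_ball_zero_le ((hum j).sub hv).enorm R

/-- The function `f` with `e^{(n-2)f/2}` prescribed. -/
noncomputable def logFactor (U : Sph n → ℝ≥0∞) (x : Sph n) : EReal :=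
  ((2 / ((n : ℝ) - 2) : ℝ) : EReal) * ENNReal.log (U x)

theorem extConformalFactor_logFactor (hn : 3 ≤ n) (U : Sph n → ℝ≥0∞) :
    extConformalFactor (logFactor U) = U := by
  have h : (3 : ℝ) ≤ n := by exact_mod_cast hn
  have h2 : (n : ℝ) - 2 ≠ 0 := by linarith
  funext x
  rw [extConformalFactor, logFactor, ← mul_assoc, ← EReal.coe_mul,
    show ((n : ℝ) - 2) / 2 * (2 / ((n : ℝ) - 2)) = 1 by field_simp, EReal.coe_one, one_mul,
    ENNReal.exp_log]

theorem meanExponent_mem (n : ℕ) : 0 < meanExponent n ∧ meanExponent n ≤ 1 := by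
  unfold meanExponent
  split_ifs with h
  · exact ⟨one_pos, le_rfl⟩
  · have h : (5 : ℝ) ≤ n := by exact_mod_cast not_le.1 h
    exact ⟨div_pos two_pos (by linarith), (div_le_one (by linarith)).2 (by linarith)⟩

end ConformalFactor

theorem mainTheorem5 (n : ℕ) (hn : 3 ≤ n) (V Λ α : ℝ) (hV : 0 < V) (hΛ : 0 < Λ)
    (hα : α ∈ Set.Ioo (0 : ℝ) 1) (f : ℕ → Sph n → ℝ)
    (hf : ∀ j, ContMDiff (𝓡 n) 𝓘(ℝ, ℝ) ∞ (f j))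
    (hSc : ∀ j x, 0 ≤ scalarCurvature (f j) x)
    (hVol_lower : ∀ j, ENNReal.ofReal V⁻¹ ≤ conformalVol (f j) Set.univ)
    (hVol_upper : ∀ j, conformalVol (f j) Set.univ ≤ ENNReal.ofReal V)
    (hUI : ∀ j (U : Set (Sph n)), MeasurableSet U →
      conformalVol (f j) U ≤ ENNReal.ofReal Λ * roundVol n U ^ α) :
    -- a subsequence of the conformal factors has a limit
    (∃ (φ : ℕ → ℕ) (u : Sph n → ℝ), StrictMono φ ∧
      ∀ p : ℝ, 1 ≤ p → p < 2 * n / ((n : ℝ) - 2) →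
        MemLp u (ENNReal.ofReal p) (roundVol n) ∧
        Tendsto (fun k => eLpNorm (fun x => conformalFactor (f (φ k)) x - u x)
          (ENNReal.ofReal p) (roundVol n)) atTop (𝓝 0)) ∧
    -- each such limit is defined everywhere, positive and lower semicontinuous
    (∀ (φ : ℕ → ℕ) (u : Sph n → ℝ), StrictMono φ → MemLp u 1 (roundVol n) →
      Tendsto (fun k => eLpNorm (fun x => conformalFactor (f (φ k)) x - u x)
        1 (roundVol n)) atTop (𝓝 0) →
      ∃ fInf : Sph n → EReal,
        (∀ᵐ x ∂(roundVol n), extConformalFactor fInf x = ENNReal.ofReal (u x)) ∧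
        (∀ x, Tendsto (fun s : ℝ => ⨍⁻ y in geodBall x s,
            ENNReal.ofReal (u y) ^ meanExponent n ∂(roundVol n)) (𝓝[>] 0)
          (𝓝 (extConformalFactor fInf x ^ meanExponent n))) ∧
        (∀ x, 0 < extConformalFactor fInf x) ∧
        LowerSemicontinuous (extConformalFactor fInf)) := by
  have hfm : ∀ j, Measurable (f j) := fun j => (hf j).continuous.measurable
  have hum : ∀ j, Measurable (conformalFactor (f j)) := fun j => measurable_conformalFactor (hfm j)
  refine ⟨?_, ?_⟩
  · have hsup : ∀ j x r, r ∈ Set.Ioo 0 ‖x‖ →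
        ballMean (fun y => ENNReal.ofReal (homExt (conformalFactor (f j)) y)) x r ≤
          ENNReal.ofReal (homExt (conformalFactor (f j)) x) := fun j x r hr =>
      ballMean_ofReal_le (homExt_nonneg fun p => (conformalFactor_pos _ p).le)
        (fun x hx => (contDiffAt_homExt_conformalFactor (hf j) hx).of_le
          (by norm_cast))
        (fun x hx => laplacian_homExt_nonpos hn (hf j) (hSc j) hx) hr
    obtain ⟨φ, v, hφ, hv, hlim⟩ := exists_subseq_tendsto_eLpNorm_one
      (fun j p => (conformalFactor_pos (f j) p).le) hum hsup
      (M := roundVol n Set.univ + ENNReal.ofReal V)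
      (ENNReal.add_ne_top.2 ⟨measure_ne_top _ _, ENNReal.ofReal_ne_top⟩) fun j =>
        (lintegral_conformalFactor_sq_le hn (f j)).trans (add_le_add_right (hVol_upper j) _)
    obtain ⟨hvq, hq⟩ := tendsto_conformalFactor_critical hn hα.1 (fun k => hfm (φ k))
      (fun k => hVol_upper (φ k)) (fun k => hUI (φ k)) hv hlim
    refine ⟨φ, v, hφ, fun p hp1 hp => ?_⟩
    have hpq : ENNReal.ofReal p ≤ ENNReal.ofReal (criticalExponent n) :=
      ENNReal.ofReal_le_ofReal hp.le
    exact ⟨hvq.mono_exponent hpq, tendsto_eLpNorm_of_exponent_le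
      (by simpa using by linarith) hpq
      (fun k => ((hum (φ k)).aestronglyMeasurable.sub hv.1)) hq⟩
  · intro φ u _ hu hlim
    -- replace the limit by a measurable function that agrees with it almost everywhere
    set v := hu.1.mk u
    have huv : u =ᵐ[roundVol n] v := hu.1.ae_eq_mk
    have hvm : Measurable v := hu.1.stronglyMeasurable_mk.measurable
    have hv1 : MemLp v 1 (roundVol n) := hu.ae_eq huv
    have hlimv : Tendsto (fun k => eLpNorm (fun x => conformalFactor (f (φ k)) x - v x) 1
        (roundVol n)) atTop (𝓝 0) := by
      refine hlim.congr fun k => eLpNorm_congr_ae ?_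
      filter_upwards [huv] with x hx
      rw [hx]
    have hv0 : 0 ≤ᵐ[roundVol n] v := by
      obtain ⟨ns, -, hns⟩ := (tendstoInMeasure_of_tendsto_eLpNorm one_ne_zero
        (fun k => (hum (φ k)).aestronglyMeasurable) hv1.1 hlimv).exists_seq_tendsto_ae
      filter_upwards [hns] with x hx
      exact ge_of_tendsto' hx fun k => (conformalFactor_pos _ x).le
    set U : Sph n → ℝ≥0∞ := fun p => ENNReal.ofReal (v p) with hUdef
    have hU : Measurable U := hvm.ennreal_ofReal
    have hS : IsSuperMean (lhomExt U) := isSuperMean_of_tendsto (fun k => hum (φ k))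
      (fun k => isSuperMean_conformalFactor hn (hf (φ k)) (hSc (φ k))) hvm hlimv
    have hUi : ∫⁻ p, U p ∂roundVol n ≠ ⊤ := by
      refine ne_top_of_le_ne_top hv1.2.ne ?_
      rw [eLpNorm_one_eq_lintegral_enorm]
      exact lintegral_mono fun p => Real.ofReal_le_enorm _
    have hU0 : ∫⁻ p, U p ∂roundVol n ≠ 0 := by
      intro h
      refine not_ae_eq_zero_of_tendsto hn hV (fun k => hVol_lower (φ k))
        (tendsto_conformalFactor_critical hn hα.1 (fun k => hfm (φ k))
          (fun k => hVol_upper (φ k)) (fun k => hUI (φ k)) hv1 hlimv).2 ?_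
      filter_upwards [(lintegral_eq_zero_iff hU).1 h, hv0] with x hx hx0
      exact le_antisymm (ENNReal.ofReal_eq_zero.1 hx) hx0
    obtain ⟨hβ0, hβ1⟩ := meanExponent_mem n
    refine ⟨logFactor (sphReg U), ?_⟩
    rw [extConformalFactor_logFactor hn]
    refine ⟨?_, fun x => ?_, sphReg_pos (by lia) hS hU hUi hU0, lowerSemicontinuous_sphReg U⟩
    · filter_upwards [sphReg_ae_eq hS hU hUi, huv] with x hx hxv
      rw [hx, hxv]
    · refine (tendsto_laverage_geodBall hS hU hUi (by lia) hβ0 hβ1 x).congr fun s => ?_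
      refine laverage_congr (ae_restrict_of_ae ?_)
      filter_upwards [huv] with y hy
      rw [hUdef, hy]
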